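/- All Hilbert spaces are finite-dimensional. A state is a positive semidefinite operator of trace one; a quantum channel is a completely positive trace-preserving linear map $\Phi:\mathcal B(\mathcal H)\to\mathcal B(\mathcal K)$, and $\Phi^\dagger$ is its adjoint for the Hilbert–Schmidt inner product; $\|X\|_1=\operatorname{tr}|X|$. The channel $\Phi$ is sufficient for $\{\rho,\sigma\}$ if there is a channel $\mathcal R:\mathcal B(\mathcal K)\to\mathcal B(\mathcal H)$ with $\mathcal R\Phi(\rho)=\rho$ and $\mathcal R\Phi(\sigma)=\sigma$. An operator anti-monotone function $g:(0,\infty)\to(0,\infty)$ has a unique representation $g(x)=c+\int_{[0,\infty)}\frac{1}{s+x}\,d\nu_g(s)$ with $c\ge 0$ and a positive measure $\nu_g$; it is called regular if Lebesgue measure on $(0,\infty)$ is absolutely continuous with respect to $\nu_g$. (The normalization $g(1)=1$ and the symmetry $g(1/x)=x\,g(x)$ are not required.) For states $\rho,\sigma$ with $\operatorname{supp}\rho\subseteq\operatorname{supp}\sigma$ and spectral decomposition $\sigma=\sum_i\lambda_i|\phi_i\rangle\langle\phi_i|$, the $\chi^2$-divergence associated with $g$ is $$\chi^2_g(\rho,\sigma)=\sum_{i,j:\,\lambda_i,\lambda_j>0}\lambda_j^{-1}\,g(\lambda_i\lambda_j^{-1})\,|\langle\phi_i|(\rho-\sigma)|\phi_j\rangle|^2,$$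 that is, $\langle \rho-\sigma,\ g(L_\sigma R_\sigma^{-1})R_\sigma^{-1}(\rho-\sigma)\rangle$ on the support of $\sigma$, with $L_\sigma,R_\sigma$ left and right multiplication by $\sigma$. It is called regular if $g$ is. For $t\in\mathbb R$ the rotated Petz map is $$\mathcal R^t_{\sigma,\Phi}(A)=\sigma^{\frac12-it}\,\Phi^\dagger\big(\Phi(\sigma)^{-\frac12+it}A\,\Phi(\sigma)^{-\frac12-it}\big)\,\sigma^{\frac12+it},$$ with powers taken on the supports. **Theorem.** (1) Let $\rho,\sigma$ be states on $\mathcal H$ with $\operatorname{supp}\rho\subseteq\operatorname{supp}\sigma$ and let $\Phi:\mathcal B(\mathcal H)\to\mathcal B(\mathcal K)$ be a quantum channel. The following are equivalent: (a) $\Phi$ is sufficient for $\{\rho,\sigma\}$; (b) $\chi^2_g(\rho,\sigma)=\chi^2_g(\Phi(\rho),\Phi(\sigma))$ for some regular $g$; (c) $\chi^2_g(\rho,\sigma)=\chi^2_g(\Phi(\rho),\Phi(\sigma))$ for all regular $g$. (2) For every regular $g$ and every $\lambda>0$ there is a constant $K=K(g,\lambda)>0$, depending only on $g$ and $\lambda$,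 such that for all $\mathcal H$, $\mathcal K$, all states $\rho,\sigma$ on $\mathcal H$ with $\sigma>\lambda I$, all quantum channels $\Phi:\mathcal B(\mathcal H)\to\mathcal B(\mathcal K)$ and all $t\in\mathbb R$, $$\chi^2_g(\rho,\sigma)-\chi^2_g(\Phi(\rho),\Phi(\sigma))\ \ge\ \frac{\pi}{\cosh(\pi t)}\,K\,\big\|\rho-\mathcal R^t_{\sigma,\Phi}\Phi(\rho)\big\|_1^2 .$$ -/

import Mathlib

open MeasureTheory
open scoped Matrix ComplexOrder

universe u v

noncomputable section

namespace QChi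

/-- `B(H)` for a finite-dimensional Hilbert space `H` with orthonormal basis indexed by `n`. -/
abbrev Op (n : Type u) : Type u := Matrix n n ℂ

section Basic

variable {n : Type u} [Fintype n] [DecidableEq n] {m : Type v} [Fintype m] [DecidableEq m]

/-- A state (density operator): positive semidefinite with trace one. -/
def IsState (ρ : Op n) : Prop := ρ.PosSemidef ∧ ρ.trace = 1

/-- The support of a Hermitian operator: its range (the orthogonal complement of its kernel). -/
def supp (ρ : Op n) : Submodule ℂ (n → ℂ) := LinearMap.range ρ.mulVecLin

/-- The amplification `Φ ⊗ id_k` of a linear map on operators. -/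
def amplify (Φ : Op n →ₗ[ℂ] Op m) (k : ℕ) (X : Op (n × Fin k)) : Op (m × Fin k) :=
  fun p q => Φ (fun a b => X (a, p.2) (b, q.2)) p.1 q.1

/-- A quantum channel: a completely positive trace-preserving linear map. -/
def IsChannel (Φ : Op n →ₗ[ℂ] Op m) : Prop :=
  (∀ (k : ℕ) (X : Op (n × Fin k)), X.PosSemidef → (amplify Φ k X).PosSemidef) ∧
    ∀ X : Op n, (Φ X).trace = X.trace

/-- `Φ` is sufficient for `{ρ, σ}`: some channel recovers both states from the outputs of `Φ`. -/
def IsSufficient (Φ : Op n →ₗ[ℂ] Op m) (ρ σ : Op n) : Prop :=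
  ∃ R : Op m →ₗ[ℂ] Op n, IsChannel R ∧ R (Φ ρ) = ρ ∧ R (Φ σ) = σ

/-- Spectral functional calculus `f(A) = ∑ᵢ f(λᵢ) |φᵢ⟩⟨φᵢ|` of a Hermitian `A = ∑ᵢ λᵢ |φᵢ⟩⟨φᵢ|`
(and `0` if `A` is not Hermitian). -/
def matFun (f : ℝ → ℂ) (A : Op n) : Op n :=
  if h : A.IsHermitian then
    (h.eigenvectorUnitary : Op n) * Matrix.diagonal (fun i => f (h.eigenvalues i)) *
      (h.eigenvectorUnitary : Op n)ᴴ
  else 0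

/-- Complex powers `A ^ z` of a positive semidefinite operator, taken on its support
and zero on its kernel. -/
def opPow (A : Op n) (z : ℂ) : Op n :=
  matFun (fun x => if x = 0 then 0 else (x : ℂ) ^ z) A

/-- The trace norm `‖X‖₁ = tr |X| = tr √(X* X)`. -/
def traceNorm (X : Op n) : ℝ :=
  ∑ i, Real.sqrt ((Matrix.isHermitian_conjTranspose_mul_self X).eigenvalues i)

/-- The adjoint `Φ†` of a linear map for the Hilbert-Schmidt inner products `⟨A, B⟩ = tr (A* B)`. -/
def hsAdjoint (Φ : Op n →ₗ[ℂ] Op m) (Y : Op m) : Op n :=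
  fun i j => ((Φ (Matrix.single i j 1))ᴴ * Y).trace

/-- The defining property of the adjoint: `⟨X, Φ† Y⟩ = ⟨Φ X, Y⟩`. -/
theorem trace_conjTranspose_mul_hsAdjoint (Φ : Op n →ₗ[ℂ] Op m) (X : Op n) (Y : Op m) :
    (Xᴴ * hsAdjoint Φ Y).trace = ((Φ X)ᴴ * Y).trace := by
  have hX : X = ∑ i, ∑ j, X i j • Matrix.single i j (1 : ℂ) := by
    conv_lhs => rw [Matrix.matrix_eq_sum_single X]
    simp [Matrix.smul_single]
  have hR : ((Φ X)ᴴ * Y).trace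
      = ∑ i, ∑ j, star (X i j) * ((Φ (Matrix.single i j 1))ᴴ * Y).trace := by
    conv_lhs => rw [hX]
    simp only [map_sum, map_smul, Matrix.conjTranspose_sum, Matrix.conjTranspose_smul,
      Matrix.sum_mul, Matrix.trace_sum, Matrix.smul_mul, Matrix.trace_smul, smul_eq_mul]
  rw [hR, Finset.sum_comm]
  simp [Matrix.trace, Matrix.mul_apply, hsAdjoint]

/-- The rotated Petz recovery map
`R^t(A) = σ^{1/2 - it} Φ†(Φ(σ)^{-1/2 + it} A Φ(σ)^{-1/2 - it}) σ^{1/2 + it}`. -/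
def rotatedPetz (σ : Op n) (Φ : Op n →ₗ[ℂ] Op m) (t : ℝ) (A : Op m) : Op n :=
  opPow σ (1 / 2 - Complex.I * t) *
    hsAdjoint Φ (opPow (Φ σ) (-1 / 2 + Complex.I * t) * A *
      opPow (Φ σ) (-1 / 2 - Complex.I * t)) *
    opPow σ (1 / 2 + Complex.I * t)

/-- The quadratic form `γ_σ^g(A) = ⟨A, g(L_σ R_σ⁻¹) R_σ⁻¹ A⟩` of the metric given by `g`, for `A`
supported on the support of `σ`: if `σ = ∑ᵢ λᵢ |φᵢ⟩⟨φᵢ|` then it is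
`∑ c(λᵢ, λⱼ) |⟨φᵢ| A |φⱼ⟩|²` over `λᵢ, λⱼ ≠ 0`, where `c(x, y) = y⁻¹ g(x y⁻¹)`. -/
def metric (g : ℝ → ℝ) (σ A : Op n) : ℝ :=
  if h : σ.IsHermitian then
    ∑ i, ∑ j, if h.eigenvalues i = 0 ∨ h.eigenvalues j = 0 then 0 else
      (h.eigenvalues j)⁻¹ * g (h.eigenvalues i * (h.eigenvalues j)⁻¹) *
        ‖((h.eigenvectorUnitary : Op n)ᴴ * A * (h.eigenvectorUnitary : Op n)) i j‖ ^ 2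
  else 0

/-- The quantum `χ²`-divergence `χ²_g(ρ, σ) = γ_σ^g(ρ - σ)`, for `supp ρ ⊆ supp σ`. -/
def chiSq (g : ℝ → ℝ) (ρ σ : Op n) : ℝ := metric g σ (ρ - σ)

end Basic

/-- `g` is operator anti-monotone (operator decreasing) on `(0, ∞)`. -/
def OperatorAntitone (g : ℝ → ℝ) : Prop :=
  ∀ (d : ℕ) (X Y : Op (Fin d)), X.PosDef → (Y - X).PosSemidef →
    (matFun (fun x => (g x : ℂ)) X - matFun (fun x => (g x : ℂ)) Y).PosSemidef

/-- `ν` is the measure on `[0, ∞)` in the canonical integral representation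
`g(x) = c + ∫ 1/(s + x) dν(s)`, `x > 0`, `c ≥ 0`, of the operator anti-monotone function `g`.
The pair `(c, ν)` is determined by `g`. -/
def IsRepresentingMeasure (g : ℝ → ℝ) (ν : Measure ℝ) : Prop :=
  ν (Set.Iio 0) = 0 ∧
    (∀ x : ℝ, 0 < x → Integrable (fun s : ℝ => 1 / (s + x)) ν) ∧
    ∃ c : ℝ, 0 ≤ c ∧ ∀ x : ℝ, 0 < x → g x = c + ∫ s, 1 / (s + x) ∂ν

/-- `g : (0, ∞) → (0, ∞)` is a regular operator anti-monotone function: Lebesgue measure on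
`(0, ∞)` is absolutely continuous with respect to the representing measure of `g`.
Only the values of `g` on `(0, ∞)` matter. The symmetry `g(1/x) = x g(x)` and the normalization
`g(1) = 1` are not imposed, so that functions with these properties are a special case. -/
structure IsRegular (g : ℝ → ℝ) : Prop where
  pos : ∀ x : ℝ, 0 < x → 0 < g x
  antitone : OperatorAntitone g
  regular : ∃ ν : Measure ℝ, IsRepresentingMeasure g ν ∧ volume.restrict (Set.Ioi 0) ≪ ν

end QChi

end

/-! Write `A = ρ - σ`. By the integral representation, the metric of `g` is a nonnegative
combination of the metric of the constant function and of the resolvent metrics `⟨A, X_s⟩`, where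
`X_s = (L_σ + s R_σ)⁻¹ A`. Let `Y_s` be the corresponding resolvent for `Φ(σ)` and `Φ(A)`.
Completing the square (`resolvLoss_eq`), the loss of the `s`-th metric equals `defectL + s *
defectR` at `(X_s, Y_s)`. These defects are nonnegative quadratic forms by complete positivity, and
a small left defect means that `X_s` is close to `Φ†(Y_s)` in the `σ`-weighted norm
(`trace_conj_sub_le_defectL`). This already gives monotonicity, hence that sufficiency implies
preservation.

For recovery, `A` and the argument of `Φ†` in the rotated Petz map are obtained from the function `x
^ (-1/2 + it)` of the relative modular operator, so this function has to be expressed through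
resolvents. Regularity of `g` provides nodes `s_k` in disjoint intervals at which the resolvent loss
is at most a constant times the total loss (`exists_node_le`). On the finite relative spectrum of
`σ` the power is interpolated exactly by a combination of `N + 1` resolvents
(`exists_interpolation`). The relative spectrum of `Φ(σ)` is not controlled, and there the error is
`u * G`, where `u` is a combination of resolvents vanishing on the relative spectrum of `σ`. The
input operator of `u` is therefore zero, so the defect of `u` bounds its output operator, and the
growth bounds on `G` carry this over to `u * G` (`traceNorm_sub_rotatedPetz_sq_le`).

The factor `cosh (π t)` comes from the size `exp (π |t| / 2)` of the power on the right half plane,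
squared. The constant depends on `g`, on a lower bound for the nonzero eigenvalues of `σ` and on the
input dimension; if `σ > λ` then trace one bounds the dimension by `1 / λ`. When the loss vanishes,
the Petz map at `t = 0` recovers `ρ`, and completing it off the support of `Φ(σ)` gives a recovery
channel (`isSufficient_of_petz`). -/

noncomputable section

set_option linter.unusedSectionVars false

namespace QChi

/-! ### Functions of the relative modular operator as Schur multipliers in an eigenbasis. -/

section SchurCalculus

variable {n : Type u} [Fintype n] [DecidableEq n]

/-- The matrix of `A` in the eigenbasis of the Hermitian matrix `σ`. -/
def eigCoord {σ : Op n} (h : σ.IsHermitian) (A : Op n) : Op n :=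
  (h.eigenvectorUnitary : Op n)ᴴ * A * (h.eigenvectorUnitary : Op n)

/-- The operator whose matrix in the eigenbasis of `σ` is `C`. -/
def ofEigCoord {σ : Op n} (h : σ.IsHermitian) (C : Op n) : Op n :=
  (h.eigenvectorUnitary : Op n) * C * (h.eigenvectorUnitary : Op n)ᴴ

variable {σ : Op n} (h : σ.IsHermitian)

theorem unitary_conjTranspose_mul :
    (h.eigenvectorUnitary : Op n)ᴴ * (h.eigenvectorUnitary : Op n) = 1 :=
  Unitary.coe_star_mul_self h.eigenvectorUnitary

theorem unitary_mul_conjTranspose :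
    (h.eigenvectorUnitary : Op n) * (h.eigenvectorUnitary : Op n)ᴴ = 1 :=
  Unitary.coe_mul_star_self h.eigenvectorUnitary

theorem eigCoord_ofEigCoord (C : Op n) : eigCoord h (ofEigCoord h C) = C := by
  unfold eigCoord ofEigCoord
  have e := unitary_conjTranspose_mul h
  set U := (h.eigenvectorUnitary : Op n)
  calc Uᴴ * (U * C * Uᴴ) * U = (Uᴴ * U) * C * (Uᴴ * U) := by simp only [mul_assoc]
    _ = C := by rw [e]; simp

theorem ofEigCoord_eigCoord (A : Op n) : ofEigCoord h (eigCoord h A) = A := by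
  unfold eigCoord ofEigCoord
  have e := unitary_mul_conjTranspose h
  set U := (h.eigenvectorUnitary : Op n)
  calc U * (Uᴴ * A * U) * Uᴴ = (U * Uᴴ) * A * (U * Uᴴ) := by simp only [mul_assoc]
    _ = A := by rw [e]; simp

theorem eigCoord_injective : Function.Injective (eigCoord h) :=
  Function.LeftInverse.injective (ofEigCoord_eigCoord h)

theorem eigCoord_mul (A B : Op n) : eigCoord h (A * B) = eigCoord h A * eigCoord h B := by
  unfold eigCoord
  have e := unitary_mul_conjTranspose h
  set U := (h.eigenvectorUnitary : Op n)
  calc Uᴴ * (A * B) * U = Uᴴ * A * 1 * B * U := by simp only [mul_assoc, one_mul]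
    _ = _ := by rw [← e]; simp only [mul_assoc]

theorem eigCoord_conjTranspose (A : Op n) : eigCoord h Aᴴ = (eigCoord h A)ᴴ := by
  simp [eigCoord, Matrix.conjTranspose_mul, mul_assoc]

theorem eigCoord_add (A B : Op n) : eigCoord h (A + B) = eigCoord h A + eigCoord h B := by
  simp [eigCoord, mul_add, add_mul]

theorem eigCoord_sub (A B : Op n) : eigCoord h (A - B) = eigCoord h A - eigCoord h B := by
  simp [eigCoord, mul_sub, sub_mul]

theorem eigCoord_smul (c : ℂ) (A : Op n) : eigCoord h (c • A) = c • eigCoord h A := by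
  simp [eigCoord]

theorem eigCoord_sum {ι : Type*} (s : Finset ι) (A : ι → Op n) :
    eigCoord h (∑ i ∈ s, A i) = ∑ i ∈ s, eigCoord h (A i) := by
  simp [eigCoord, Matrix.mul_sum, Matrix.sum_mul]

theorem trace_eigCoord (A : Op n) : (eigCoord h A).trace = A.trace := by
  unfold eigCoord
  rw [Matrix.trace_mul_comm, ← mul_assoc, unitary_mul_conjTranspose, one_mul]

theorem matFun_eq (f : ℝ → ℂ) :
    matFun f σ = ofEigCoord h (Matrix.diagonal fun i => f (h.eigenvalues i)) := by
  simp [matFun, h, ofEigCoord]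

theorem eigCoord_matFun (f : ℝ → ℂ) :
    eigCoord h (matFun f σ) = Matrix.diagonal fun i => f (h.eigenvalues i) := by
  rw [matFun_eq h, eigCoord_ofEigCoord]

theorem matFun_ofReal {σ : Op n} (h : σ.IsHermitian) : matFun (fun x => (x : ℂ)) σ = σ := by
  rw [matFun_eq h]
  conv_rhs => rw [h.spectral_theorem, Unitary.conjStarAlgAut_apply]
  rfl

theorem eigCoord_self : eigCoord h σ = Matrix.diagonal fun i => (h.eigenvalues i : ℂ) := by
  have := eigCoord_matFun h fun x => (x : ℂ)
  rwa [matFun_ofReal h] at this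

theorem eigCoord_one : eigCoord h 1 = 1 := by
  simp [eigCoord, unitary_conjTranspose_mul]

theorem trace_conjTranspose_mul_eq_sum (A B : Op n) :
    (Aᴴ * B).trace = ∑ i, ∑ j, star (eigCoord h A i j) * eigCoord h B i j := by
  rw [← trace_eigCoord h, eigCoord_mul, eigCoord_conjTranspose, Finset.sum_comm]
  simp [Matrix.trace, Matrix.mul_apply]

/-- `A` vanishes on the kernel of `σ`. -/
def KerLE (σ A : Op n) : Prop := ∀ w : n → ℂ, σ *ᵥ w = 0 → A *ᵥ w = 0

theorem eigCoord_eq_zero_right {A : Op n} (hA : KerLE σ A) {i j : n}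
    (hj : h.eigenvalues j = 0) : eigCoord h A i j = 0 := by
  have hw : A *ᵥ (fun a => (h.eigenvectorUnitary : Op n) a j) = 0 := by
    apply hA
    have := h.mulVec_eigenvectorBasis j
    rw [hj, zero_smul] at this
    exact this
  rw [eigCoord, mul_assoc, Matrix.mul_apply]
  refine Finset.sum_eq_zero fun a _ => ?_
  have : (A * (h.eigenvectorUnitary : Op n)) a j = 0 := congrFun hw a
  rw [this, mul_zero]

theorem eigCoord_eq_zero {A : Op n} (hA : KerLE σ A) (hA' : A.IsHermitian) {i j : n}
    (hij : h.eigenvalues i = 0 ∨ h.eigenvalues j = 0) : eigCoord h A i j = 0 := by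
  rcases hij with hi | hj
  · have h1 : eigCoord h A = (eigCoord h A)ᴴ := by rw [← eigCoord_conjTranspose, hA'.eq]
    rw [h1, Matrix.conjTranspose_apply, eigCoord_eq_zero_right h hA hi, star_zero]
  · exact eigCoord_eq_zero_right h hA hj

/-- `φ(L_σ R_σ⁻¹) R_σ⁻¹ A`, for `A` supported on the support of `σ`. -/
def modFun {σ : Op n} (h : σ.IsHermitian) (φ : ℝ → ℂ) (A : Op n) : Op n :=
  ofEigCoord h (Matrix.of fun i j => ((h.eigenvalues j : ℂ))⁻¹ *
    φ (h.eigenvalues i * (h.eigenvalues j)⁻¹) * eigCoord h A i j)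

theorem eigCoord_modFun (φ : ℝ → ℂ) (A : Op n) (i j : n) :
    eigCoord h (modFun h φ A) i j = ((h.eigenvalues j : ℂ))⁻¹ *
    φ (h.eigenvalues i * (h.eigenvalues j)⁻¹) * eigCoord h A i j := by
  rw [modFun, eigCoord_ofEigCoord, Matrix.of_apply]

theorem modFun_sum {ι : Type*} (s : Finset ι) (c : ι → ℂ) (φ : ι → ℝ → ℂ) (A : Op n) :
    modFun h (fun x => ∑ i ∈ s, c i * φ i x) A = ∑ i ∈ s, c i • modFun h (φ i) A := by
  apply eigCoord_injective h
  ext i j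
  rw [eigCoord_modFun, eigCoord_sum, Matrix.sum_apply, Finset.mul_sum, Finset.sum_mul]
  refine Finset.sum_congr rfl fun k _ => ?_
  rw [eigCoord_smul, Matrix.smul_apply, eigCoord_modFun, smul_eq_mul]
  ring

theorem modFun_add (φ ψ : ℝ → ℂ) (A : Op n) :
    modFun h (fun x => φ x + ψ x) A = modFun h φ A + modFun h ψ A := by
  apply eigCoord_injective h
  ext i j
  rw [eigCoord_add, Matrix.add_apply]
  simp only [eigCoord_modFun]
  ring

/-- Coordinates of `A` at zero eigenvalues vanish, so only the finitely many ratios of nonzero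
eigenvalues matter. This is what makes interpolation on the relative spectrum exact. -/
theorem modFun_congr {A : Op n} (hA : KerLE σ A) (hA' : A.IsHermitian) {φ ψ : ℝ → ℂ}
    (H : ∀ i j, h.eigenvalues i ≠ 0 → h.eigenvalues j ≠ 0 →
      φ (h.eigenvalues i * (h.eigenvalues j)⁻¹) = ψ (h.eigenvalues i * (h.eigenvalues j)⁻¹)) :
    modFun h φ A = modFun h ψ A := by
  apply eigCoord_injective h
  ext i j
  rw [eigCoord_modFun, eigCoord_modFun]
  by_cases hij : h.eigenvalues i = 0 ∨ h.eigenvalues j = 0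
  · rw [eigCoord_eq_zero h hA hA' hij, mul_zero, mul_zero]
  · push Not at hij
    rw [H i j hij.1 hij.2]

theorem metric_eq_sum (g : ℝ → ℝ) {A : Op n} (hA : KerLE σ A) (hA' : A.IsHermitian) :
    metric g σ A = ∑ i, ∑ j, (h.eigenvalues j)⁻¹ * g (h.eigenvalues i * (h.eigenvalues j)⁻¹) *
      ‖eigCoord h A i j‖ ^ 2 := by
  rw [metric, dif_pos h]
  refine Finset.sum_congr rfl fun i _ => Finset.sum_congr rfl fun j _ => ?_
  split_ifs with hij
  · rw [eigCoord_eq_zero h hA hA' hij]; simp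
  · rfl

theorem metric_eq_trace (g : ℝ → ℝ) {A : Op n} (hA : KerLE σ A) (hA' : A.IsHermitian) :
    metric g σ A = ((modFun h (fun x => (g x : ℂ)) A)ᴴ * A).trace.re := by
  rw [metric_eq_sum h g hA hA', trace_conjTranspose_mul_eq_sum h, Complex.re_sum]
  refine Finset.sum_congr rfl fun i _ => ?_
  rw [Complex.re_sum]
  refine Finset.sum_congr rfl fun j _ => ?_
  rw [eigCoord_modFun, ← Complex.normSq_eq_norm_sq, ← Complex.ofReal_inv, Complex.star_def]
  simp only [map_mul, Complex.conj_ofReal, Complex.normSq_apply, Complex.mul_re, Complex.mul_im,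
    Complex.ofReal_re, Complex.ofReal_im, Complex.conj_re, Complex.conj_im]
  ring

/-- `(L_σ + s R_σ)` inverts `modFun` for the resolvent function. -/
theorem mul_modFun_add_modFun_mul (hσ : ∀ i, 0 ≤ h.eigenvalues i) {s : ℝ} (hs : 0 ≤ s) {A : Op n}
    (hA : KerLE σ A) (hA' : A.IsHermitian) :
    σ * modFun h (fun x => ((1 / (s + x) : ℝ) : ℂ)) A
      + (s : ℂ) • (modFun h (fun x => ((1 / (s + x) : ℝ) : ℂ)) A * σ) = A := by
  apply eigCoord_injective h
  ext i j
  rw [eigCoord_add, eigCoord_smul, eigCoord_mul, eigCoord_mul, eigCoord_self, Matrix.add_apply,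
    Matrix.smul_apply, Matrix.diagonal_mul, Matrix.mul_diagonal, eigCoord_modFun, smul_eq_mul]
  by_cases hij : h.eigenvalues i = 0 ∨ h.eigenvalues j = 0
  · rw [eigCoord_eq_zero h hA hA' hij]; simp
  · push Not at hij
    have hi : 0 < h.eigenvalues i := lt_of_le_of_ne (hσ i) hij.1.symm
    have hj : 0 < h.eigenvalues j := lt_of_le_of_ne (hσ j) hij.2.symm
    have h1 : s * h.eigenvalues j + h.eigenvalues i ≠ 0 := by positivity
    have h2 : (h.eigenvalues j)⁻¹ * (1 / (s + h.eigenvalues i * (h.eigenvalues j)⁻¹))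
        * (s * h.eigenvalues j + h.eigenvalues i) = 1 := by
      have : s + h.eigenvalues i * (h.eigenvalues j)⁻¹ ≠ 0 := by positivity
      field_simp
    have h3 : ((h.eigenvalues j : ℂ))⁻¹ *
        ((1 / (s + h.eigenvalues i * (h.eigenvalues j)⁻¹) : ℝ) : ℂ)
        * ((s : ℂ) * h.eigenvalues j + h.eigenvalues i) = 1 := by exact_mod_cast h2
    linear_combination (eigCoord h A i j) * h3

theorem modFun_one_mul {A : Op n} (hA : KerLE σ A) (hA' : A.IsHermitian) :
    modFun h (fun _ => ((1 : ℝ) : ℂ)) A * σ = A := by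
  apply eigCoord_injective h
  ext i j
  rw [eigCoord_mul, eigCoord_self, Matrix.mul_diagonal, eigCoord_modFun]
  by_cases hij : h.eigenvalues i = 0 ∨ h.eigenvalues j = 0
  · rw [eigCoord_eq_zero h hA hA' hij]; simp
  · push Not at hij
    have : (h.eigenvalues j : ℂ) ≠ 0 := by exact_mod_cast hij.2
    field_simp
    simp

theorem matFun_conjTranspose {σ : Op n} (h : σ.IsHermitian) (f : ℝ → ℂ) :
    (matFun f σ)ᴴ = matFun (fun x => star (f x)) σ := by
  apply eigCoord_injective h
  rw [eigCoord_conjTranspose, eigCoord_matFun, eigCoord_matFun, Matrix.diagonal_conjTranspose]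
  rfl

theorem matFun_mul {σ : Op n} (h : σ.IsHermitian) (f g : ℝ → ℂ) :
    matFun f σ * matFun g σ = matFun (fun x => f x * g x) σ := by
  apply eigCoord_injective h
  rw [eigCoord_mul, eigCoord_matFun, eigCoord_matFun, eigCoord_matFun, Matrix.diagonal_mul_diagonal]

theorem matFun_congr {f g : ℝ → ℂ} (H : ∀ i, f (h.eigenvalues i) = g (h.eigenvalues i)) :
    matFun f σ = matFun g σ := by
  rw [matFun_eq h, matFun_eq h]; simp only [H]

theorem matFun_mul_matFun (f g : ℝ → ℂ) (A : Op n) (i j : n) :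
    eigCoord h (matFun f σ * A * matFun g σ) i j
      = f (h.eigenvalues i) * eigCoord h A i j * g (h.eigenvalues j) := by
  rw [eigCoord_mul, eigCoord_mul, eigCoord_matFun, eigCoord_matFun, Matrix.mul_diagonal,
    Matrix.diagonal_mul]

end SchurCalculus

/-! ### Complete positivity and the quadratic defect forms of a channel. -/

section Channel

variable {n : Type u} [Fintype n] [DecidableEq n] {m : Type v} [Fintype m] [DecidableEq m]

/-- The positive semidefinite block operator `[σ, σX; X*σ, X*σX]`. -/
def gramBlock (σ X : Op n) : Op (n × Fin 2) :=
  (Matrix.of fun (p : n) (q : n × Fin 2) => (![1, X] q.2) p q.1)ᴴ * σ *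
    (Matrix.of fun (p : n) (q : n × Fin 2) => (![1, X] q.2) p q.1)

theorem amplify_gramBlock (Φ : Op n →ₗ[ℂ] Op m) (σ X : Op n) (p q : m) (k l : Fin 2) :
    amplify Φ 2 (gramBlock σ X) (p, k) (q, l) = Φ ((![1, X] k)ᴴ * σ * ![1, X] l) p q := by
  simp only [amplify]
  congr 2

theorem amplify_gramBlock_posSemidef {Φ : Op n →ₗ[ℂ] Op m} (hΦ : IsChannel Φ) {σ : Op n}
    (hσ : σ.PosSemidef) (X : Op n) : (amplify Φ 2 (gramBlock σ X)).PosSemidef :=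
  hΦ.1 2 _ (hσ.conjTranspose_mul_mul_same _)

/-- For `σ = 1` the off-diagonal blocks of the Gram operator are `X` and `Xᴴ`; the image block
operator is Hermitian. -/
theorem IsChannel.map_conjTranspose {Φ : Op n →ₗ[ℂ] Op m} (hΦ : IsChannel Φ) (X : Op n) :
    Φ Xᴴ = (Φ X)ᴴ := by
  have h := (amplify_gramBlock_posSemidef hΦ Matrix.PosSemidef.one X).isHermitian
  ext p q
  have := h.apply (p, 1) (q, 0)
  rw [amplify_gramBlock, amplify_gramBlock] at this
  simpa using this.symm

theorem IsChannel.map_isHermitian {Φ : Op n →ₗ[ℂ] Op m} (hΦ : IsChannel Φ) {X : Op n}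
    (hX : X.IsHermitian) : (Φ X).IsHermitian := by
  rw [Matrix.IsHermitian, ← hΦ.map_conjTranspose, hX.eq]

theorem IsChannel.map_posSemidef {Φ : Op n →ₗ[ℂ] Op m} (hΦ : IsChannel Φ) {X : Op n}
    (hX : X.PosSemidef) : (Φ X).PosSemidef := by
  have h := (amplify_gramBlock_posSemidef hΦ hX 1).submatrix (fun p : m => (p, (0 : Fin 2)))
  convert h using 1
  ext p q
  rw [Matrix.submatrix_apply, amplify_gramBlock]
  simp

/-- `⟨X, σX⟩ - 2 Re ⟨Y, Φ(σX)⟩ + ⟨Y, Φ(σ)Y⟩`, the defect of monotonicity for left multiplication. -/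
def defectL (Φ : Op n →ₗ[ℂ] Op m) (σ X : Op n) (Y : Op m) : ℝ :=
  (Xᴴ * σ * X).trace.re - 2 * (Yᴴ * Φ (σ * X)).trace.re + (Yᴴ * Φ σ * Y).trace.re

/-- The defect of monotonicity for right multiplication. -/
def defectR (Φ : Op n →ₗ[ℂ] Op m) (σ X : Op n) (Y : Op m) : ℝ :=
  (X * σ * Xᴴ).trace.re - 2 * (Yᴴ * Φ (X * σ)).trace.re + (Y * Φ σ * Yᴴ).trace.re

theorem trace_re_conjTranspose (X : Op n) : Xᴴ.trace.re = X.trace.re := by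
  rw [Matrix.trace_conjTranspose]; simp

theorem defectR_eq {Φ : Op n →ₗ[ℂ] Op m} (hΦ : IsChannel Φ) {σ : Op n} (hσ : σ.IsHermitian)
    (X : Op n) (Y : Op m) : defectR Φ σ X Y = defectL Φ σ Xᴴ Yᴴ := by
  have : (Yᴴ * Φ (X * σ)).trace.re = (Y * Φ (σ * Xᴴ)).trace.re := by
    rw [← trace_re_conjTranspose, Matrix.conjTranspose_mul, Matrix.conjTranspose_conjTranspose,
      ← hΦ.map_conjTranspose, Matrix.conjTranspose_mul, hσ.eq, Matrix.trace_mul_comm]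
  simp only [defectR, defectL, Matrix.conjTranspose_conjTranspose, this]

/-- The image under `Φ ⊗ id₂` of the Gram block operator of `(1, X)` is positive. Compressing it by
the column `(-Y, 1)` and taking the trace gives the defect; trace preservation turns the block
`Φ(XᴴσX)` into `XᴴσX`. -/
theorem defectL_nonneg {Φ : Op n →ₗ[ℂ] Op m} (hΦ : IsChannel Φ) {σ : Op n} (hσ : σ.PosSemidef)
    (X : Op n) (Y : Op m) : 0 ≤ defectL Φ σ X Y := by
  have h := ((amplify_gramBlock_posSemidef hΦ hσ X).conjTranspose_mul_mul_same
    (Matrix.of fun (p : m × Fin 2) (c : m) => (![-Y, 1] p.2) p.1 c)).trace_nonneg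
  have key : (((Matrix.of fun (p : m × Fin 2) (c : m) => (![-Y, 1] p.2) p.1 c)ᴴ *
      amplify Φ 2 (gramBlock σ X) *
      (Matrix.of fun (p : m × Fin 2) (c : m) => (![-Y, 1] p.2) p.1 c))).trace
      = (Yᴴ * Φ σ * Y).trace - (Yᴴ * Φ (σ * X)).trace - (Φ (Xᴴ * σ) * Y).trace
        + (Φ (Xᴴ * σ * X)).trace := by
    have e : ((Matrix.of fun (p : m × Fin 2) (c : m) => (![-Y, 1] p.2) p.1 c)ᴴ *
      amplify Φ 2 (gramBlock σ X) *
      (Matrix.of fun (p : m × Fin 2) (c : m) => (![-Y, 1] p.2) p.1 c))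
      = Yᴴ * Φ σ * Y - Yᴴ * Φ (σ * X) - Φ (Xᴴ * σ) * Y + Φ (Xᴴ * σ * X) := by
      have e1 : ∀ c (q : m) (l : Fin 2),
          ((Matrix.of fun (p : m × Fin 2) (c : m) => (![-Y, 1] p.2) p.1 c)ᴴ *
          amplify Φ 2 (gramBlock σ X)) c (q, l)
          = (-Yᴴ * Φ (σ * ![1, X] l) + Φ (Xᴴ * σ * ![1, X] l)) c q := by
        intro c q l
        rw [Matrix.mul_apply, Fintype.sum_prod_type]
        simp only [Fin.sum_univ_two, amplify_gramBlock, Matrix.conjTranspose_apply,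
          Matrix.of_apply, Finset.sum_add_distrib, Matrix.add_apply]
        congr 1
        · simp [Matrix.mul_apply]
        · simp [Matrix.one_apply, apply_ite]
      ext c d
      rw [Matrix.mul_apply, Fintype.sum_prod_type]
      simp only [Fin.sum_univ_two, e1, Matrix.of_apply, Finset.sum_add_distrib]
      have e2 : ∀ Z W : Op m, ∑ x, Z c x * W x d = (Z * W) c d := fun Z W => by
        rw [Matrix.mul_apply]
      rw [show ![-Y, (1 : Op m)] 0 = -Y from rfl, show ![-Y, (1 : Op m)] 1 = 1 from rfl, e2, e2]
      simp only [← Matrix.add_apply]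
      refine congrFun (congrFun ?_ c) d
      simp only [Matrix.cons_val_zero, Matrix.cons_val_one, mul_one]
      noncomm_ring
    rw [e]
    simp only [Matrix.trace_add, Matrix.trace_sub]
  rw [key, hΦ.2] at h
  have h2 : (Φ (Xᴴ * σ) * Y).trace.re = (Yᴴ * Φ (σ * X)).trace.re := by
    rw [← trace_re_conjTranspose, Matrix.conjTranspose_mul, ← hΦ.map_conjTranspose,
      Matrix.conjTranspose_mul, Matrix.conjTranspose_conjTranspose, hσ.isHermitian.eq]
  have h3 := (Complex.le_def.1 h).1
  simp only [Complex.add_re, Complex.sub_re, Complex.zero_re, h2] at h3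
  unfold defectL
  linarith

theorem defectR_nonneg {Φ : Op n →ₗ[ℂ] Op m} (hΦ : IsChannel Φ) {σ : Op n} (hσ : σ.PosSemidef)
    (X : Op n) (Y : Op m) : 0 ≤ defectR Φ σ X Y := by
  rw [defectR_eq hΦ hσ.isHermitian]
  exact defectL_nonneg hΦ hσ _ _

theorem defectL_parallelogram (Φ : Op n →ₗ[ℂ] Op m) (σ X X' : Op n) (Y Y' : Op m) :
    defectL Φ σ (X + X') (Y + Y') + defectL Φ σ (X - X') (Y - Y')
      = 2 * defectL Φ σ X Y + 2 * defectL Φ σ X' Y' := by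
  simp only [defectL, Matrix.conjTranspose_add, Matrix.conjTranspose_sub, mul_add, add_mul,
    mul_sub, sub_mul, map_add, map_sub, Matrix.trace_add, Matrix.trace_sub, Complex.add_re,
    Complex.sub_re]
  ring

theorem trace_smul_smul_re (c : ℂ) (A B : Op n) :
    ((star c • A) * (c • B)).trace.re = Complex.normSq c * (A * B).trace.re := by
  rw [Matrix.smul_mul, Matrix.mul_smul, smul_smul, Matrix.trace_smul, smul_eq_mul,
    show star c * c = (Complex.normSq c : ℂ) by
      rw [mul_comm, Complex.star_def, Complex.mul_conj], Complex.re_ofReal_mul]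

theorem defectL_smul (Φ : Op n →ₗ[ℂ] Op m) (σ X : Op n) (Y : Op m) (c : ℂ) :
    defectL Φ σ (c • X) (c • Y) = Complex.normSq c * defectL Φ σ X Y := by
  simp only [defectL, Matrix.conjTranspose_smul, Matrix.smul_mul (star c), Matrix.mul_smul,
    map_smul]
  simp only [← Matrix.smul_mul (star c), ← Matrix.mul_smul, trace_smul_smul_re]
  simp only [Matrix.smul_mul (star c), Matrix.mul_smul,smul_smul, Matrix.trace_smul, smul_eq_mul,
    show star c * c = (Complex.normSq c : ℂ) by
      rw [mul_comm, Complex.star_def, Complex.mul_conj], Complex.re_ofReal_mul]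
  ring

/-- The sum of the two defects. -/
def defect (Φ : Op n →ₗ[ℂ] Op m) (σ X : Op n) (Y : Op m) : ℝ :=
  defectL Φ σ X Y + defectR Φ σ X Y

theorem defect_nonneg {Φ : Op n →ₗ[ℂ] Op m} (hΦ : IsChannel Φ) {σ : Op n} (hσ : σ.PosSemidef)
    (X : Op n) (Y : Op m) : 0 ≤ defect Φ σ X Y :=
  add_nonneg (defectL_nonneg hΦ hσ X Y) (defectR_nonneg hΦ hσ X Y)

/-- The parallelogram law with the nonnegative difference term dropped. -/
theorem defect_add_le {Φ : Op n →ₗ[ℂ] Op m} (hΦ : IsChannel Φ) {σ : Op n} (hσ : σ.PosSemidef)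
    (X X' : Op n) (Y Y' : Op m) :
    defect Φ σ (X + X') (Y + Y') ≤ 2 * defect Φ σ X Y + 2 * defect Φ σ X' Y' := by
  have h1 := defectL_parallelogram Φ σ X X' Y Y'
  have h2 := defectL_parallelogram Φ σ Xᴴ X'ᴴ Yᴴ Y'ᴴ
  have h3 := defectL_nonneg hΦ hσ (X - X') (Y - Y')
  have h4 := defectL_nonneg hΦ hσ (Xᴴ - X'ᴴ) (Yᴴ - Y'ᴴ)
  simp only [defect, defectR_eq hΦ hσ.isHermitian, Matrix.conjTranspose_add]
  linarith

theorem defect_smul {Φ : Op n →ₗ[ℂ] Op m} (hΦ : IsChannel Φ) {σ : Op n} (hσ : σ.PosSemidef)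
    (X : Op n) (Y : Op m) (c : ℂ) :
    defect Φ σ (c • X) (c • Y) = ‖c‖ ^ 2 * defect Φ σ X Y := by
  simp only [defect, defectR_eq hΦ hσ.isHermitian, Matrix.conjTranspose_smul, defectL_smul]
  rw [← Complex.normSq_eq_norm_sq, Complex.star_def, Complex.normSq_conj]
  ring

theorem defect_sum_le {Φ : Op n →ₗ[ℂ] Op m} (hΦ : IsChannel Φ) {σ : Op n} (hσ : σ.PosSemidef)
    {ι : Type*} (s : Finset ι) (c : ι → ℂ) (X : ι → Op n) (Y : ι → Op m) :
    defect Φ σ (∑ i ∈ s, c i • X i) (∑ i ∈ s, c i • Y i)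
      ≤ 2 ^ s.card * ∑ i ∈ s, ‖c i‖ ^ 2 * defect Φ σ (X i) (Y i) := by
  classical
  induction s using Finset.induction_on with
  | empty => simp [defect, defectL, defectR]
  | insert a s ha ih =>
    rw [Finset.sum_insert ha, Finset.sum_insert ha, Finset.sum_insert ha,
      Finset.card_insert_of_notMem ha]
    refine (defect_add_le hΦ hσ _ _ _ _).trans ?_
    rw [defect_smul hΦ hσ, pow_succ (2 : ℝ)]
    have h1 : (1 : ℝ) ≤ 2 ^ s.card := one_le_pow₀ (by norm_num)
    have h2 : 0 ≤ ‖c a‖ ^ 2 * defect Φ σ (X a) (Y a) :=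
      mul_nonneg (by positivity) (defect_nonneg hΦ hσ _ _)
    nlinarith [mul_nonneg (sub_nonneg.2 h1) h2]

/-- The trace pairing characterisation of the adjoint. -/
theorem trace_hsAdjoint (Φ : Op n →ₗ[ℂ] Op m) (X : Op n) (Y : Op m) :
    ((hsAdjoint Φ Y)ᴴ * X).trace = (Yᴴ * Φ X).trace := by
  have := congrArg star (trace_conjTranspose_mul_hsAdjoint Φ X Y)
  simpa [← Matrix.trace_conjTranspose, Matrix.conjTranspose_mul] using this

/-- After expanding both sides, the difference is exactly the left defect at `(Φ†(Y), Y)`, which is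
nonnegative. -/
theorem trace_conj_sub_le_defectL {Φ : Op n →ₗ[ℂ] Op m} (hΦ : IsChannel Φ) {σ : Op n}
    (hσ : σ.PosSemidef) (X : Op n) (Y : Op m) :
    ((X - hsAdjoint Φ Y)ᴴ * σ * (X - hsAdjoint Φ Y)).trace.re ≤ defectL Φ σ X Y := by
  have h := defectL_nonneg hΦ hσ (hsAdjoint Φ Y) Y
  unfold defectL at h ⊢
  rw [← trace_hsAdjoint] at h ⊢
  set Z := hsAdjoint Φ Y
  have e : (Xᴴ * σ * Z).trace.re = (Zᴴ * (σ * X)).trace.re := by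
    rw [← trace_re_conjTranspose]
    simp [Matrix.conjTranspose_mul, hσ.isHermitian.eq]
  simp only [Matrix.conjTranspose_sub, mul_sub, sub_mul, Matrix.trace_sub, Complex.sub_re, e]
  simp only [← mul_assoc] at h ⊢
  linarith

theorem trace_hsAdjoint_left_le {Φ : Op n →ₗ[ℂ] Op m} (hΦ : IsChannel Φ) {σ : Op n}
    (hσ : σ.PosSemidef) (Y : Op m) :
    ((hsAdjoint Φ Y)ᴴ * σ * hsAdjoint Φ Y).trace.re ≤ (Yᴴ * Φ σ * Y).trace.re := by
  have := trace_conj_sub_le_defectL hΦ hσ 0 Y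
  simpa [defectL] using this

theorem hsAdjoint_conjTranspose {Φ : Op n →ₗ[ℂ] Op m} (hΦ : IsChannel Φ) (Y : Op m) :
    hsAdjoint Φ Yᴴ = (hsAdjoint Φ Y)ᴴ := by
  ext i j
  simp only [hsAdjoint, Matrix.conjTranspose_apply]
  rw [← Matrix.trace_conjTranspose, Matrix.conjTranspose_mul, Matrix.conjTranspose_conjTranspose,
    ← hΦ.map_conjTranspose, Matrix.conjTranspose_single, Matrix.trace_mul_comm, star_one]

theorem trace_hsAdjoint_right_le {Φ : Op n →ₗ[ℂ] Op m} (hΦ : IsChannel Φ) {σ : Op n}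
    (hσ : σ.PosSemidef) (Y : Op m) :
    (hsAdjoint Φ Y * σ * (hsAdjoint Φ Y)ᴴ).trace.re ≤ (Y * Φ σ * Yᴴ).trace.re := by
  have := trace_hsAdjoint_left_le hΦ hσ Yᴴ
  rwa [hsAdjoint_conjTranspose hΦ, Matrix.conjTranspose_conjTranspose,
    Matrix.conjTranspose_conjTranspose] at this

theorem hsAdjoint_add (Φ : Op n →ₗ[ℂ] Op m) (Y Z : Op m) :
    hsAdjoint Φ (Y + Z) = hsAdjoint Φ Y + hsAdjoint Φ Z := by
  ext i j; simp [hsAdjoint, mul_add]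

theorem hsAdjoint_sub (Φ : Op n →ₗ[ℂ] Op m) (Y Z : Op m) :
    hsAdjoint Φ (Y - Z) = hsAdjoint Φ Y - hsAdjoint Φ Z := by
  ext i j; simp [hsAdjoint, mul_sub]

theorem hsAdjoint_smul (Φ : Op n →ₗ[ℂ] Op m) (c : ℂ) (Y : Op m) :
    hsAdjoint Φ (c • Y) = c • hsAdjoint Φ Y := by
  ext i j; simp [hsAdjoint]

theorem hsAdjoint_one {Φ : Op n →ₗ[ℂ] Op m} (hΦ : IsChannel Φ) : hsAdjoint Φ 1 = 1 := by
  ext i j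
  simp only [hsAdjoint, mul_one]
  rw [Matrix.trace_conjTranspose, hΦ.2]
  by_cases hij : i = j
  · subst hij; simp
  · simp [hij]

end Channel

/-! ### Loss of the resolvent metrics, and monotonicity of the mixture. -/

section Monotonicity

variable {n : Type u} [Fintype n] [DecidableEq n] {m : Type v} [Fintype m] [DecidableEq m]

theorem mulVec_eq_zero_of_dotProduct {w : n → ℂ} (h : star w ⬝ᵥ w = 0) : w = 0 :=
  dotProduct_star_self_eq_zero.1 (dotProduct_comm w (star w) ▸ h)

theorem kerLE_of_supp_le {ρ σ : Op n} (hρ : ρ.IsHermitian) (hσ : σ.IsHermitian)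
    (h : supp ρ ≤ supp σ) : KerLE σ ρ := by
  intro w hw
  obtain ⟨y, hy⟩ := h (LinearMap.mem_range_self ρ.mulVecLin (ρ *ᵥ w))
  simp only [Matrix.mulVecLin_apply] at hy
  apply mulVec_eq_zero_of_dotProduct
  rw [Matrix.star_mulVec, hρ.eq, ← Matrix.dotProduct_mulVec, ← hy, Matrix.dotProduct_mulVec]
  have : star w ᵥ* σ = 0 := by
    have := Matrix.star_mulVec σ w
    rw [hw, hσ.eq] at this
    simpa using this.symm
  rw [this, zero_dotProduct]

theorem KerLE.sub {σ A B : Op n} (hA : KerLE σ A) (hB : KerLE σ B) : KerLE σ (A - B) := by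
  intro w hw
  rw [Matrix.sub_mulVec, hA w hw, hB w hw, sub_zero]

theorem kerLE_refl (σ : Op n) : KerLE σ σ := fun _ h => h

theorem KerLE.exists_eq_mul {σ A : Op n} (hσ : σ.IsHermitian) (hA : KerLE σ A)
    (hA' : A.IsHermitian) : ∃ X, A = σ * X := by
  refine ⟨modFun hσ (fun x => ((x : ℂ))⁻¹) A, eigCoord_injective hσ ?_⟩
  ext i j
  rw [eigCoord_mul, eigCoord_self, Matrix.diagonal_mul, eigCoord_modFun]
  by_cases hij : hσ.eigenvalues i = 0 ∨ hσ.eigenvalues j = 0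
  · rw [eigCoord_eq_zero hσ hA hA' hij]; simp
  · push Not at hij
    have h1 : (hσ.eigenvalues i : ℂ) ≠ 0 := by exact_mod_cast hij.1
    have h2 : (hσ.eigenvalues j : ℂ) ≠ 0 := by exact_mod_cast hij.2
    push_cast
    field_simp

/-- Channels preserve inclusion of kernels. -/
theorem KerLE.map {Φ : Op n →ₗ[ℂ] Op m} (hΦ : IsChannel Φ) {σ A : Op n} (hσ : σ.PosSemidef)
    (hA : KerLE σ A) (hA' : A.IsHermitian) : KerLE (Φ σ) (Φ A) := by
  obtain ⟨X, hX⟩ := hA.exists_eq_mul hσ.isHermitian hA'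
  intro w hw
  set B := Φ A with hB
  have hBh : B.IsHermitian := hΦ.map_isHermitian hA'
  set r : ℝ := (star (B *ᵥ w) ⬝ᵥ (B *ᵥ w)).re with hr
  -- Test the left defect with `Y = κ w (Bw)*`. Since `Φ(σ) w = 0` the term quadratic in `κ`
  -- disappears, and an affine function bounded below on `κ ≥ 0` cannot have slope `-2r < 0`.
  have key : ∀ κ : ℝ, 0 ≤ (Xᴴ * σ * X).trace.re - 2 * (κ * r) := by
    intro κ
    have h := defectL_nonneg hΦ hσ X ((κ : ℂ) • Matrix.vecMulVec w (star (B *ᵥ w)))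
    have e1 : Φ σ * ((κ : ℂ) • Matrix.vecMulVec w (star (B *ᵥ w))) = 0 := by
      rw [Matrix.mul_smul, Matrix.mul_vecMulVec, hw, Matrix.zero_vecMulVec, smul_zero]
    have e2 : (((κ : ℂ) • Matrix.vecMulVec w (star (B *ᵥ w)))ᴴ * B).trace.re = κ * r := by
      rw [Matrix.conjTranspose_smul, Matrix.conjTranspose_vecMulVec, star_star, Matrix.smul_mul,
        Matrix.vecMulVec_mul, Matrix.trace_smul, Matrix.trace_vecMulVec, smul_eq_mul,
        Complex.star_def, Complex.conj_ofReal, Complex.re_ofReal_mul, hr, dotProduct_comm,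
        Matrix.star_mulVec, hBh.eq]
    rw [defectL, mul_assoc _ (Φ σ), e1, ← hX, ← hB, e2] at h
    simpa using h
  have hr0 : 0 ≤ star (B *ᵥ w) ⬝ᵥ (B *ᵥ w) := dotProduct_star_self_nonneg _
  have hr1 : r = 0 := by
    have h0 : 0 ≤ r := (Complex.le_def.1 hr0).1
    by_contra hne
    have hpos : 0 < r := lt_of_le_of_ne h0 (Ne.symm hne)
    have := key (((Xᴴ * σ * X).trace.re + 1) / r)
    rw [div_mul_cancel₀ _ hne] at this
    have := key 0
    linarith
  apply mulVec_eq_zero_of_dotProduct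
  apply Complex.ext
  · exact hr1
  · exact (Complex.le_def.1 hr0).2.symm

/-- `(L_σ + s R_σ)⁻¹ A` on the support of `σ`. -/
def resolv {σ : Op n} (h : σ.IsHermitian) (s : ℝ) (A : Op n) : Op n :=
  modFun h (fun x => ((1 / (s + x) : ℝ) : ℂ)) A

theorem modFun_resolvent {σ : Op n} (h : σ.IsHermitian) (s : ℝ) (A : Op n) :
    modFun h (fun x => ((1 / (s + x) : ℝ) : ℂ)) A = resolv h s A := rfl

/-- The loss of the resolvent metric under `Φ`. -/
def resolvLoss (Φ : Op n →ₗ[ℂ] Op m) (σ A : Op n) (s : ℝ) : ℝ :=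
  metric (fun x => 1 / (s + x)) σ A - metric (fun x => 1 / (s + x)) (Φ σ) (Φ A)

theorem metric_resolvent {σ A : Op n} (hσ : σ.PosSemidef) (hA : KerLE σ A) (hA' : A.IsHermitian)
    {s : ℝ} (hs : 0 ≤ s) :
    metric (fun x => 1 / (s + x)) σ A
      = ((resolv hσ.isHermitian s A)ᴴ * σ * resolv hσ.isHermitian s A).trace.re
        + s * (resolv hσ.isHermitian s A * σ * (resolv hσ.isHermitian s A)ᴴ).trace.re := by
  rw [metric_eq_trace hσ.isHermitian _ hA hA']
  conv_lhs => rw [← mul_modFun_add_modFun_mul hσ.isHermitian hσ.eigenvalues_nonneg hs hA hA']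
  simp only [modFun_resolvent]
  set X := resolv hσ.isHermitian s A
  have e : resolv hσ.isHermitian s (σ * X + (s : ℂ) • (X * σ)) = X := by
    simp only [X, ← modFun_resolvent, mul_modFun_add_modFun_mul hσ.isHermitian hσ.eigenvalues_nonneg hs hA hA']
  rw [e, mul_add, Matrix.trace_add, Complex.add_re, ← mul_assoc, Matrix.mul_smul,
    Matrix.trace_smul, smul_eq_mul, Complex.re_ofReal_mul, Matrix.trace_mul_comm _ (X * σ)]

/-- Substituting `A = σX + sXσ` into `⟨Y, Φ(A)⟩` produces the cross terms of the two defects. The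
output metric equals both `⟨Y, Φ(A)⟩` and the quadratic form in `Y`, so subtracting it amounts to
subtracting twice the former and adding the latter. -/
theorem resolvLoss_eq {Φ : Op n →ₗ[ℂ] Op m} (hΦ : IsChannel Φ) {σ A : Op n} (hσ : σ.PosSemidef)
    (hA : KerLE σ A) (hA' : A.IsHermitian) {s : ℝ} (hs : 0 ≤ s) :
    resolvLoss Φ σ A s
      = defectL Φ σ (resolv hσ.isHermitian s A)
          (resolv (hΦ.map_posSemidef hσ).isHermitian s (Φ A))
        + s * defectR Φ σ (resolv hσ.isHermitian s A)
          (resolv (hΦ.map_posSemidef hσ).isHermitian s (Φ A)) := by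
  have hτ := hΦ.map_posSemidef hσ
  have hB := hA.map hΦ hσ hA'
  have hB' := hΦ.map_isHermitian hA'
  have h1 := metric_resolvent hτ hB hB' hs
  have h2 := metric_eq_trace hτ.isHermitian (fun x => 1 / (s + x)) hB hB'
  have h3 := mul_modFun_add_modFun_mul hσ.isHermitian hσ.eigenvalues_nonneg hs hA hA'
  simp only [modFun_resolvent] at h2 h3
  rw [resolvLoss, metric_resolvent hσ hA hA' hs]
  set X := resolv hσ.isHermitian s A
  set Y := resolv hτ.isHermitian s (Φ A)
  have h4 : (Yᴴ * Φ A).trace.re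
      = (Yᴴ * Φ (σ * X)).trace.re + s * (Yᴴ * Φ (X * σ)).trace.re := by
    conv_lhs => rw [← h3]
    rw [map_add, map_smul, mul_add, Matrix.mul_smul, Matrix.trace_add, Matrix.trace_smul,
      smul_eq_mul, Complex.add_re, Complex.re_ofReal_mul]
  unfold defectL defectR
  linarith

theorem resolvLoss_nonneg {Φ : Op n →ₗ[ℂ] Op m} (hΦ : IsChannel Φ) {σ A : Op n}
    (hσ : σ.PosSemidef) (hA : KerLE σ A) (hA' : A.IsHermitian) {s : ℝ} (hs : 0 ≤ s) :
    0 ≤ resolvLoss Φ σ A s := by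
  rw [resolvLoss_eq hΦ hσ hA hA' hs]
  exact add_nonneg (defectL_nonneg hΦ hσ _ _) (mul_nonneg hs (defectR_nonneg hΦ hσ _ _))

/-- For `s ≥ 1` the weight `s` on the right defect is at least its weight in `defect`; hence nodes
are taken from `[1, ∞)`. -/
theorem defect_resolv_le {Φ : Op n →ₗ[ℂ] Op m} (hΦ : IsChannel Φ) {σ A : Op n}
    (hσ : σ.PosSemidef) (hA : KerLE σ A) (hA' : A.IsHermitian) {s : ℝ} (hs : 1 ≤ s) :
    defect Φ σ (resolv hσ.isHermitian s A)
      (resolv (hΦ.map_posSemidef hσ).isHermitian s (Φ A)) ≤ resolvLoss Φ σ A s := by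
  rw [resolvLoss_eq hΦ hσ hA hA' (zero_le_one.trans hs), defect]
  have := defectR_nonneg hΦ hσ (resolv hσ.isHermitian s A)
      (resolv (hΦ.map_posSemidef hσ).isHermitian s (Φ A))
  nlinarith

theorem metric_one {σ A : Op n} (hσ : σ.PosSemidef) (hA : KerLE σ A) (hA' : A.IsHermitian) :
    ∃ X : Op n, X * σ = A ∧ metric (fun _ => 1) σ A = (X * σ * Xᴴ).trace.re ∧
      metric (fun _ => 1) σ A = (Xᴴ * A).trace.re := by
  refine ⟨_, modFun_one_mul hσ.isHermitian hA hA', ?_, metric_eq_trace hσ.isHermitian _ hA hA'⟩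
  rw [metric_eq_trace hσ.isHermitian _ hA hA', modFun_one_mul hσ.isHermitian hA hA',
    Matrix.trace_mul_comm]

/-- Handles the constant `c` of the integral representation: the same square, with right
multiplication alone. -/
theorem metric_one_mono {Φ : Op n →ₗ[ℂ] Op m} (hΦ : IsChannel Φ) {σ A : Op n}
    (hσ : σ.PosSemidef) (hA : KerLE σ A) (hA' : A.IsHermitian) :
    metric (fun _ => 1) (Φ σ) (Φ A) ≤ metric (fun _ => 1) σ A := by
  obtain ⟨X, hX, h1, -⟩ := metric_one hσ hA hA'
  obtain ⟨Y, -, h2, h3⟩ := metric_one (hΦ.map_posSemidef hσ) (hA.map hΦ hσ hA')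
    (hΦ.map_isHermitian hA')
  have := defectR_nonneg hΦ hσ X Y
  rw [defectR, ← h1, hX, ← h3, ← h2] at this
  linarith

/-- The metric of `g` as a mixture of resolvent metrics. -/
theorem metric_eq_integral {g : ℝ → ℝ} {ν : Measure ℝ} {c : ℝ}
    (hν : ∀ x : ℝ, 0 < x → Integrable (fun s : ℝ => 1 / (s + x)) ν)
    (hg : ∀ x : ℝ, 0 < x → g x = c + ∫ s, 1 / (s + x) ∂ν)
    {σ : Op n} (hσ : σ.PosSemidef) (A : Op n) :
    Integrable (fun s => metric (fun x => 1 / (s + x)) σ A) ν ∧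
      metric g σ A = c * metric (fun _ => 1) σ A + ∫ s, metric (fun x => 1 / (s + x)) σ A ∂ν := by
  have h := hσ.isHermitian
  have hint : ∀ i j, Integrable (fun s => if h.eigenvalues i = 0 ∨ h.eigenvalues j = 0 then 0 else
      (h.eigenvalues j)⁻¹ * (1 / (s + h.eigenvalues i * (h.eigenvalues j)⁻¹)) *
        ‖((h.eigenvectorUnitary : Op n)ᴴ * A * (h.eigenvectorUnitary : Op n)) i j‖ ^ 2) ν := by
    intro i j
    by_cases hij : h.eigenvalues i = 0 ∨ h.eigenvalues j = 0
    · simp only [if_pos hij]; exact integrable_zero _ _ _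
    · simp only [if_neg hij]
      push Not at hij
      have hi : 0 < h.eigenvalues i := lt_of_le_of_ne (hσ.eigenvalues_nonneg i) hij.1.symm
      have hj : 0 < h.eigenvalues j := lt_of_le_of_ne (hσ.eigenvalues_nonneg j) hij.2.symm
      exact ((hν _ (by positivity)).const_mul _).mul_const _
  have hsum : ∀ i, Integrable (fun s => ∑ j, if h.eigenvalues i = 0 ∨ h.eigenvalues j = 0 then 0
      else (h.eigenvalues j)⁻¹ * (1 / (s + h.eigenvalues i * (h.eigenvalues j)⁻¹)) *
        ‖((h.eigenvectorUnitary : Op n)ᴴ * A * (h.eigenvectorUnitary : Op n)) i j‖ ^ 2) ν :=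
    fun i => integrable_finsetSum _ fun j _ => hint i j
  simp only [metric, dif_pos h]
  refine ⟨integrable_finsetSum _ fun i _ => hsum i, ?_⟩
  rw [integral_finsetSum _ fun i _ => hsum i, Finset.mul_sum, ← Finset.sum_add_distrib]
  refine Finset.sum_congr rfl fun i _ => ?_
  rw [integral_finsetSum _ fun j _ => hint i j, Finset.mul_sum, ← Finset.sum_add_distrib]
  refine Finset.sum_congr rfl fun j _ => ?_
  by_cases hij : h.eigenvalues i = 0 ∨ h.eigenvalues j = 0
  · simp [if_pos hij]
  · simp only [if_neg hij]
    push Not at hij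
    have hi : 0 < h.eigenvalues i := lt_of_le_of_ne (hσ.eigenvalues_nonneg i) hij.1.symm
    have hj : 0 < h.eigenvalues j := lt_of_le_of_ne (hσ.eigenvalues_nonneg j) hij.2.symm
    rw [hg _ (by positivity), integral_mul_const, integral_const_mul]
    ring

/-- The loss of the metric of `g` dominates the average loss of the resolvent metrics. -/
theorem integral_resolvLoss_le {g : ℝ → ℝ} {ν : Measure ℝ} (hν : IsRepresentingMeasure g ν)
    {Φ : Op n →ₗ[ℂ] Op m} (hΦ : IsChannel Φ) {σ A : Op n}
    (hσ : σ.PosSemidef) (hA : KerLE σ A) (hA' : A.IsHermitian) :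
    Integrable (resolvLoss Φ σ A) ν ∧
      ∫ s, resolvLoss Φ σ A s ∂ν ≤ metric g σ A - metric g (Φ σ) (Φ A) := by
  obtain ⟨-, hint, c, hc, hg⟩ := hν
  obtain ⟨i1, e1⟩ := metric_eq_integral hint hg hσ A
  obtain ⟨i2, e2⟩ := metric_eq_integral hint hg (hΦ.map_posSemidef hσ) (Φ A)
  refine ⟨i1.sub i2, ?_⟩
  have : ∫ s, resolvLoss Φ σ A s ∂ν = _ := integral_sub i1 i2
  rw [this, e1, e2]
  nlinarith [mul_le_mul_of_nonneg_left (metric_one_mono hΦ hσ hA hA') hc]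

theorem ae_resolvLoss_nonneg {ν : Measure ℝ} (hν : ν (Set.Iio 0) = 0)
    {Φ : Op n →ₗ[ℂ] Op m} (hΦ : IsChannel Φ) {σ A : Op n}
    (hσ : σ.PosSemidef) (hA : KerLE σ A) (hA' : A.IsHermitian) :
    0 ≤ᵐ[ν] resolvLoss Φ σ A := by
  have : ∀ᵐ s ∂ν, s ∉ Set.Iio (0 : ℝ) := measure_eq_zero_iff_ae_notMem.1 hν
  filter_upwards [this] with s hs
  exact resolvLoss_nonneg hΦ hσ hA hA' (not_lt.1 hs)

/-- Monotonicity of the metrics of operator anti-monotone functions. -/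
theorem metric_mono {g : ℝ → ℝ} {ν : Measure ℝ} (hν : IsRepresentingMeasure g ν)
    {Φ : Op n →ₗ[ℂ] Op m} (hΦ : IsChannel Φ) {σ A : Op n}
    (hσ : σ.PosSemidef) (hA : KerLE σ A) (hA' : A.IsHermitian) :
    metric g (Φ σ) (Φ A) ≤ metric g σ A := by
  have h1 := (integral_resolvLoss_le hν hΦ hσ hA hA').2
  have h2 := integral_nonneg_of_ae (ae_resolvLoss_nonneg hν.1 hΦ hσ hA hA')
  linarith

end Monotonicity

/-! ### The trace norm through a polar contraction, and a Hölder inequality. -/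

section TraceNorm

variable {n : Type u} [Fintype n] [DecidableEq n]

theorem trace_mul_conjTranspose_self_nonneg (X : Op n) : 0 ≤ (X * Xᴴ).trace.re :=
  (Complex.le_def.1 (Matrix.posSemidef_self_mul_conjTranspose X).trace_nonneg).1

theorem trace_conjTranspose_mul_self_nonneg (X : Op n) : 0 ≤ (Xᴴ * X).trace.re :=
  (Complex.le_def.1 (Matrix.posSemidef_conjTranspose_mul_self X).trace_nonneg).1

/-- The Cauchy-Schwarz inequality for the Hilbert-Schmidt inner product. -/
theorem trace_mul_re_sq_le (P C : Op n) :
    (P * C).trace.re ^ 2 ≤ (P * Pᴴ).trace.re * (Cᴴ * C).trace.re := by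
  have h : ∀ κ : ℝ, 0 ≤ (Cᴴ * C).trace.re * (κ * κ) + (-2 * (P * C).trace.re) * κ
      + (P * Pᴴ).trace.re := by
    intro κ
    have h0 := trace_mul_conjTranspose_self_nonneg (P - (κ : ℂ) • Cᴴ)
    have e : (Cᴴ * Pᴴ).trace.re = (P * C).trace.re := by
      rw [← Matrix.conjTranspose_mul, trace_re_conjTranspose]
    simp only [Matrix.conjTranspose_sub, Matrix.conjTranspose_smul,
      Matrix.conjTranspose_conjTranspose, mul_sub, sub_mul, Matrix.trace_sub, Matrix.smul_mul,
      Matrix.mul_smul, Matrix.trace_smul, smul_eq_mul, Complex.star_def, Complex.conj_ofReal,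
      Complex.sub_re, Complex.re_ofReal_mul, e] at h0
    linarith
  have := discrim_le_zero h
  rw [discrim] at this
  nlinarith

/-- The trace norm is attained on a contraction. -/
theorem exists_contraction_traceNorm (X : Op n) :
    ∃ W : Op n, traceNorm X = (W * X).trace.re ∧
      ∀ D : Op n, (D * W * (D * W)ᴴ).trace.re ≤ (D * Dᴴ).trace.re := by
  have h := Matrix.isHermitian_conjTranspose_mul_self X
  have hpos : ∀ i, 0 ≤ h.eigenvalues i :=
    (Matrix.posSemidef_conjTranspose_mul_self X).eigenvalues_nonneg
  -- The contraction is `|X|⁻¹ Xᴴ`. The convention `0⁻¹ = 0` makes `r` vanish at `0`, so that `W Wᴴ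
  -- = 1 - E` with `E` the projection onto the kernel of `XᴴX`.
  set r : ℝ → ℂ := fun x => ((Real.sqrt x)⁻¹ : ℝ) with hr
  refine ⟨matFun r (Xᴴ * X) * Xᴴ, ?_, fun D => ?_⟩
  · have e : matFun r (Xᴴ * X) * Xᴴ * X = matFun (fun x => r x * (x : ℂ)) (Xᴴ * X) := by
      rw [← matFun_mul h, matFun_ofReal h, mul_assoc]
    rw [e, ← trace_eigCoord h, eigCoord_matFun, Matrix.trace_diagonal, Complex.re_sum, traceNorm]
    refine Finset.sum_congr rfl fun i _ => ?_
    simp only [hr]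
    rw [← Complex.ofReal_mul, Complex.ofReal_re, mul_comm, ← div_eq_mul_inv, Real.div_sqrt]
  · set E : Op n := matFun (fun x => if x = 0 then 1 else 0) (Xᴴ * X) with hE
    have hEE : E * Eᴴ = E := by
      rw [hE, matFun_conjTranspose h, matFun_mul h]
      refine matFun_congr h fun i => ?_
      split_ifs <;> simp
    have hWW : matFun r (Xᴴ * X) * Xᴴ * (matFun r (Xᴴ * X) * Xᴴ)ᴴ = 1 - E := by
      have e1 : matFun r (Xᴴ * X) * Xᴴ * (matFun r (Xᴴ * X) * Xᴴ)ᴴ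
          = matFun r (Xᴴ * X) * (Xᴴ * X) * (matFun r (Xᴴ * X))ᴴ := by
        rw [Matrix.conjTranspose_mul, Matrix.conjTranspose_conjTranspose]
        simp only [mul_assoc]
      rw [e1]
      apply eigCoord_injective h
      rw [eigCoord_mul, eigCoord_mul, eigCoord_conjTranspose, eigCoord_sub, eigCoord_one, hE,
        eigCoord_matFun, eigCoord_matFun, eigCoord_self, Matrix.diagonal_conjTranspose,
        Matrix.diagonal_mul_diagonal, Matrix.diagonal_mul_diagonal, ← Matrix.diagonal_one,
        Matrix.diagonal_sub]
      congr 1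
      ext i
      by_cases hi : h.eigenvalues i = 0
      · simp [hr, hi]
      · have hi' : 0 < h.eigenvalues i := lt_of_le_of_ne (hpos i) (Ne.symm hi)
        have hs : Real.sqrt (h.eigenvalues i) ≠ 0 := (Real.sqrt_pos.2 hi').ne'
        simp only [hr, hi, if_false, Pi.star_apply, Complex.star_def, Complex.conj_ofReal, sub_zero]
        rw [← Complex.ofReal_mul, ← Complex.ofReal_mul]
        norm_cast
        field_simp
        rw [Real.sq_sqrt hi'.le]
    have e2 : D * (matFun r (Xᴴ * X) * Xᴴ) * (D * (matFun r (Xᴴ * X) * Xᴴ))ᴴ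
        = D * Dᴴ - D * E * (D * E)ᴴ := by
      rw [Matrix.conjTranspose_mul D, Matrix.conjTranspose_mul D]
      calc _ = D * (matFun r (Xᴴ * X) * Xᴴ * (matFun r (Xᴴ * X) * Xᴴ)ᴴ) * Dᴴ := by
            simp only [mul_assoc]
        _ = D * (1 - E * Eᴴ) * Dᴴ := by rw [hWW, hEE]
        _ = _ := by simp only [mul_sub, sub_mul, mul_one, mul_assoc]
    rw [e2, Matrix.trace_sub, Complex.sub_re]
    linarith [trace_mul_conjTranspose_self_nonneg (D * E)]

/-- With the `W` attaining the trace norm of `C * D`, this is `‖CD‖₁ ≤ ‖C‖₂ ‖D‖₂`; cyclicity moves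
`W` next to `D`. -/
theorem trace_contraction_re_sq_le {W : Op n}
    (hW : ∀ D : Op n, (D * W * (D * W)ᴴ).trace.re ≤ (D * Dᴴ).trace.re) (C D : Op n) :
    (W * (C * D)).trace.re ^ 2 ≤ (Cᴴ * C).trace.re * (D * Dᴴ).trace.re := by
  have e : (W * (C * D)).trace = (D * W * C).trace := by
    rw [← mul_assoc, Matrix.trace_mul_comm, mul_assoc]
  rw [e, mul_comm (Cᴴ * C).trace.re]
  exact (trace_mul_re_sq_le _ _).trans
    (mul_le_mul_of_nonneg_right (hW D) (trace_conjTranspose_mul_self_nonneg C))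

theorem traceNorm_eq_zero {X : Op n} (h : traceNorm X = 0) : X = 0 := by
  have hpos := (Matrix.posSemidef_conjTranspose_mul_self X).eigenvalues_nonneg
  rw [traceNorm, Finset.sum_eq_zero_iff_of_nonneg fun i _ => Real.sqrt_nonneg _] at h
  have h0 : (Matrix.isHermitian_conjTranspose_mul_self X).eigenvalues = 0 := by
    ext i
    exact (Real.sqrt_eq_zero (hpos i)).1 (h i (Finset.mem_univ i))
  exact Matrix.conjTranspose_mul_self_eq_zero.1
    ((Matrix.isHermitian_conjTranspose_mul_self X).eigenvalues_eq_zero_iff.1 h0)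

end TraceNorm

/-! ### Complex powers and the rotated square roots. -/

section Powers

variable {n : Type u} [Fintype n] [DecidableEq n]

theorem opPow_conjTranspose {σ : Op n} (hσ : σ.PosSemidef) (z : ℂ) :
    (opPow σ z)ᴴ = opPow σ (star z) := by
  have h := hσ.isHermitian
  rw [opPow, opPow, matFun_conjTranspose h]
  refine matFun_congr h fun i => ?_
  split_ifs with hi
  · simp
  · rw [Complex.star_def, Complex.cpow_conj, Complex.conj_ofReal]
    rw [Complex.arg_ofReal_of_nonneg (hσ.eigenvalues_nonneg i)]
    exact Real.pi_ne_zero.symm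

theorem opPow_mul {σ : Op n} (hσ : σ.IsHermitian) (z w : ℂ) :
    opPow σ z * opPow σ w = opPow σ (z + w) := by
  rw [opPow, opPow, opPow, matFun_mul hσ]
  refine matFun_congr hσ fun i => ?_
  split_ifs with hi
  · simp
  · rw [Complex.cpow_add _ _ (by exact_mod_cast hi)]

theorem opPow_one {σ : Op n} (hσ : σ.IsHermitian) : opPow σ 1 = σ := by
  conv_rhs => rw [← matFun_ofReal hσ]
  refine matFun_congr hσ fun i => ?_
  split_ifs with hi <;> simp [hi]

/-- The function `x ↦ x ^ (-1/2 + it)`. -/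
def rotFun (t : ℝ) (x : ℝ) : ℂ := (x : ℂ) ^ (-1 / 2 + Complex.I * t)

theorem cpow_rot_left {x y : ℝ} (hx : 0 < x) (hy : 0 < y) (t : ℝ) :
    (x : ℂ) ^ (-1 / 2 + Complex.I * t) * (y : ℂ) ^ (-1 / 2 - Complex.I * t)
      = (y : ℂ)⁻¹ * rotFun t (x * y⁻¹) := by
  have hy' : (y : ℂ) ≠ 0 := by exact_mod_cast hy.ne'
  rw [rotFun, Complex.ofReal_mul, Complex.mul_cpow_ofReal_nonneg hx.le (inv_pos.2 hy).le,
    Complex.ofReal_inv, Complex.inv_cpow _ _ (by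
      rw [Complex.arg_ofReal_of_nonneg hy.le]; exact Real.pi_ne_zero.symm)]
  have : (y : ℂ) ^ (-1 / 2 - Complex.I * t)
      = (y : ℂ)⁻¹ * ((y : ℂ) ^ (-1 / 2 + Complex.I * t))⁻¹ := by
    rw [← Complex.cpow_neg, ← Complex.cpow_neg_one, ← Complex.cpow_add _ _ hy']
    congr 1; ring
  rw [this]; ring

/-- Places the argument of `Φ†` in the rotated Petz map in the same calculus as the resolvents, with
symbol `x ^ (-1/2 + it)`. -/
theorem opPow_mul_mul_opPow {σ A : Op n} (hσ : σ.PosSemidef) (hA : KerLE σ A)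
    (hA' : A.IsHermitian) (t : ℝ) :
    opPow σ (-1 / 2 + Complex.I * t) * A * opPow σ (-1 / 2 - Complex.I * t)
      = modFun hσ.isHermitian (rotFun t) A := by
  have h := hσ.isHermitian
  apply eigCoord_injective h
  ext i j
  rw [opPow, opPow, matFun_mul_matFun, eigCoord_modFun]
  by_cases hij : h.eigenvalues i = 0 ∨ h.eigenvalues j = 0
  · rw [eigCoord_eq_zero h hA hA' hij]; simp
  · push Not at hij
    have hi : 0 < h.eigenvalues i := lt_of_le_of_ne (hσ.eigenvalues_nonneg i) hij.1.symm
    have hj : 0 < h.eigenvalues j := lt_of_le_of_ne (hσ.eigenvalues_nonneg j) hij.2.symm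
    rw [if_neg hij.1, if_neg hij.2, ← cpow_rot_left hi hj]
    ring

theorem opPow_mul_modFun_mul_opPow {σ A : Op n} (hσ : σ.PosSemidef) (hA : KerLE σ A)
    (hA' : A.IsHermitian) (t : ℝ) :
    opPow σ (1 / 2 - Complex.I * t) * modFun hσ.isHermitian (rotFun t) A *
      opPow σ (1 / 2 + Complex.I * t) = A := by
  have h := hσ.isHermitian
  apply eigCoord_injective h
  ext i j
  rw [opPow, opPow, matFun_mul_matFun, eigCoord_modFun]
  by_cases hij : h.eigenvalues i = 0 ∨ h.eigenvalues j = 0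
  · rw [eigCoord_eq_zero h hA hA' hij]; simp
  · push Not at hij
    have hi : 0 < h.eigenvalues i := lt_of_le_of_ne (hσ.eigenvalues_nonneg i) hij.1.symm
    have hj : 0 < h.eigenvalues j := lt_of_le_of_ne (hσ.eigenvalues_nonneg j) hij.2.symm
    rw [if_neg hij.1, if_neg hij.2, ← cpow_rot_left hi hj]
    have hi' : (h.eigenvalues i : ℂ) ≠ 0 := by exact_mod_cast hi.ne'
    have hj' : (h.eigenvalues j : ℂ) ≠ 0 := by exact_mod_cast hj.ne'
    have e1 : (h.eigenvalues i : ℂ) ^ (1 / 2 - Complex.I * t) *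
        (h.eigenvalues i : ℂ) ^ (-1 / 2 + Complex.I * t) = 1 := by
      rw [← Complex.cpow_add _ _ hi']
      ring_nf; simp
    have e2 : (h.eigenvalues j : ℂ) ^ (-1 / 2 - Complex.I * t) *
        (h.eigenvalues j : ℂ) ^ (1 / 2 + Complex.I * t) = 1 := by
      rw [← Complex.cpow_add _ _ hj']
      ring_nf; simp
    calc _ = ((h.eigenvalues i : ℂ) ^ (1 / 2 - Complex.I * t) *
        (h.eigenvalues i : ℂ) ^ (-1 / 2 + Complex.I * t)) *
        ((h.eigenvalues j : ℂ) ^ (-1 / 2 - Complex.I * t) *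
        (h.eigenvalues j : ℂ) ^ (1 / 2 + Complex.I * t)) * eigCoord h A i j := by ring
      _ = _ := by rw [e1, e2]; ring

theorem trace_left_eq_sum {σ : Op n} (h : σ.IsHermitian) (Z : Op n) :
    (Zᴴ * σ * Z).trace.re = ∑ i, ∑ j, h.eigenvalues i * ‖eigCoord h Z i j‖ ^ 2 := by
  rw [mul_assoc, trace_conjTranspose_mul_eq_sum h, Complex.re_sum]
  refine Finset.sum_congr rfl fun i _ => ?_
  rw [Complex.re_sum]
  refine Finset.sum_congr rfl fun j _ => ?_
  rw [eigCoord_mul, eigCoord_self, Matrix.diagonal_mul, ← Complex.normSq_eq_norm_sq,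
    Complex.star_def]
  simp only [Complex.normSq_apply, Complex.mul_re, Complex.mul_im,
    Complex.ofReal_re, Complex.ofReal_im, Complex.conj_re, Complex.conj_im]
  ring

theorem trace_right_eq_sum {σ : Op n} (h : σ.IsHermitian) (Z : Op n) :
    (Z * σ * Zᴴ).trace.re = ∑ i, ∑ j, h.eigenvalues j * ‖eigCoord h Z i j‖ ^ 2 := by
  rw [Matrix.trace_mul_comm, trace_conjTranspose_mul_eq_sum h, Complex.re_sum]
  refine Finset.sum_congr rfl fun i _ => ?_
  rw [Complex.re_sum]
  refine Finset.sum_congr rfl fun j _ => ?_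
  rw [eigCoord_mul, eigCoord_self, Matrix.mul_diagonal, ← Complex.normSq_eq_norm_sq,
    Complex.star_def]
  simp only [Complex.normSq_apply, Complex.mul_re, Complex.mul_im,
    Complex.ofReal_re, Complex.ofReal_im, Complex.conj_re, Complex.conj_im]
  ring

end Powers

/-! ### The recovery error bounded by finitely many resolvent losses. -/

section Recovery

variable {n : Type u} [Fintype n] [DecidableEq n] {m : Type v} [Fintype m] [DecidableEq m]

/-- At `x = λᵢ / λⱼ` the bound on `G` reads `λᵢ ‖G x‖² ≤ M λⱼ`: on `x ≤ 1` the factor `G` is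
absorbed by exchanging the left weight for the right one. The next lemma is the mirror image for `x
≥ 1`. -/
theorem trace_modFun_mul_left_le {τ B : Op n} (hτ : τ.PosSemidef) (hB : KerLE τ B)
    (hB' : B.IsHermitian) {φ G : ℝ → ℂ} {M : ℝ} (hM : 0 ≤ M)
    (hG : ∀ x, 0 < x → x ≤ 1 → ‖G x‖ ^ 2 ≤ M * x⁻¹) :
    ((modFun hτ.isHermitian (fun x => if x ≤ 1 then φ x * G x else 0) B)ᴴ * τ *
      modFun hτ.isHermitian (fun x => if x ≤ 1 then φ x * G x else 0) B).trace.re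
    ≤ M * (modFun hτ.isHermitian φ B * τ * (modFun hτ.isHermitian φ B)ᴴ).trace.re := by
  have h := hτ.isHermitian
  rw [trace_left_eq_sum h, trace_right_eq_sum h, Finset.mul_sum]
  refine Finset.sum_le_sum fun i _ => ?_
  rw [Finset.mul_sum]
  refine Finset.sum_le_sum fun j _ => ?_
  rw [eigCoord_modFun, eigCoord_modFun]
  by_cases hij : h.eigenvalues i = 0 ∨ h.eigenvalues j = 0
  · rw [eigCoord_eq_zero h hB hB' hij]; simp
  · push Not at hij
    have hi : 0 < h.eigenvalues i := lt_of_le_of_ne (hτ.eigenvalues_nonneg i) hij.1.symm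
    have hj : 0 < h.eigenvalues j := lt_of_le_of_ne (hτ.eigenvalues_nonneg j) hij.2.symm
    split_ifs with hx
    · have := hG _ (by positivity) hx
      have e : h.eigenvalues i * (M * (h.eigenvalues i * (h.eigenvalues j)⁻¹)⁻¹)
          = M * h.eigenvalues j := by field_simp
      have := mul_le_mul_of_nonneg_left this hi.le
      rw [e] at this
      simp only [norm_mul, mul_pow]
      calc _ = (h.eigenvalues i * ‖G (h.eigenvalues i * (h.eigenvalues j)⁻¹)‖ ^ 2) *
            (‖(h.eigenvalues j : ℂ)⁻¹‖ ^ 2 * ‖φ (h.eigenvalues i * (h.eigenvalues j)⁻¹)‖ ^ 2 *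
              ‖eigCoord h B i j‖ ^ 2) := by ring
        _ ≤ _ := mul_le_mul_of_nonneg_right this (by positivity)
        _ = _ := by ring
    · rw [mul_zero, zero_mul, norm_zero, zero_pow two_ne_zero, mul_zero]
      positivity

theorem trace_modFun_mul_right_le {τ B : Op n} (hτ : τ.PosSemidef) (hB : KerLE τ B)
    (hB' : B.IsHermitian) {φ G : ℝ → ℂ} {M : ℝ} (hM : 0 ≤ M)
    (hG : ∀ x, 1 ≤ x → ‖G x‖ ^ 2 ≤ M * x) :
    (modFun hτ.isHermitian (fun x => if x ≤ 1 then 0 else φ x * G x) B * τ *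
      (modFun hτ.isHermitian (fun x => if x ≤ 1 then 0 else φ x * G x) B)ᴴ).trace.re
    ≤ M * ((modFun hτ.isHermitian φ B)ᴴ * τ * modFun hτ.isHermitian φ B).trace.re := by
  have h := hτ.isHermitian
  rw [trace_left_eq_sum h, trace_right_eq_sum h, Finset.mul_sum]
  refine Finset.sum_le_sum fun i _ => ?_
  rw [Finset.mul_sum]
  refine Finset.sum_le_sum fun j _ => ?_
  rw [eigCoord_modFun, eigCoord_modFun]
  by_cases hij : h.eigenvalues i = 0 ∨ h.eigenvalues j = 0
  · rw [eigCoord_eq_zero h hB hB' hij]; simp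
  · push Not at hij
    have hi : 0 < h.eigenvalues i := lt_of_le_of_ne (hτ.eigenvalues_nonneg i) hij.1.symm
    have hj : 0 < h.eigenvalues j := lt_of_le_of_ne (hτ.eigenvalues_nonneg j) hij.2.symm
    split_ifs with hx
    · rw [mul_zero, zero_mul, norm_zero, zero_pow two_ne_zero, mul_zero]
      positivity
    · have := hG _ (not_le.1 hx).le
      have e : h.eigenvalues j * (M * (h.eigenvalues i * (h.eigenvalues j)⁻¹))
          = M * h.eigenvalues i := by field_simp
      have := mul_le_mul_of_nonneg_left this hj.le
      rw [e] at this
      simp only [norm_mul, mul_pow]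
      calc _ = (h.eigenvalues j * ‖G (h.eigenvalues i * (h.eigenvalues j)⁻¹)‖ ^ 2) *
            (‖(h.eigenvalues j : ℂ)⁻¹‖ ^ 2 * ‖φ (h.eigenvalues i * (h.eigenvalues j)⁻¹)‖ ^ 2 *
              ‖eigCoord h B i j‖ ^ 2) := by ring
        _ ≤ _ := mul_le_mul_of_nonneg_right this (by positivity)
        _ = _ := by ring

/-- Interpolating `x ^ (-1/2 + it)` by resolvents on the relative spectrum of `σ`, the recovery
error is controlled by finitely many resolvent losses. -/
theorem traceNorm_sub_rotatedPetz_sq_le {Φ : Op n →ₗ[ℂ] Op m} (hΦ : IsChannel Φ) {σ A : Op n}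
    (hσ : σ.PosSemidef) (htr : σ.trace = 1) (hA : KerLE σ A) (hA' : A.IsHermitian) (t : ℝ)
    {ι : Type*} [Fintype ι] {s : ι → ℝ} (hs : ∀ k, 1 ≤ s k) {c w : ι → ℂ} {G : ℝ → ℂ} {M : ℝ}
    (hM : 0 ≤ M)
    (hw : ∀ i j, hσ.isHermitian.eigenvalues i ≠ 0 → hσ.isHermitian.eigenvalues j ≠ 0 →
      ∑ k, w k * ((1 / (s k + hσ.isHermitian.eigenvalues i *
        (hσ.isHermitian.eigenvalues j)⁻¹) : ℝ) : ℂ) = 0)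
    (hf : ∀ x : ℝ, 0 < x → rotFun t x = ∑ k, c k * ((1 / (s k + x) : ℝ) : ℂ)
      + (∑ k, w k * ((1 / (s k + x) : ℝ) : ℂ)) * G x)
    (hG0 : ∀ x, 0 < x → x ≤ 1 → ‖G x‖ ^ 2 ≤ M * x⁻¹)
    (hG1 : ∀ x, 1 ≤ x → ‖G x‖ ^ 2 ≤ M * x) :
    traceNorm (A - rotatedPetz σ Φ t (Φ A)) ^ 2
      ≤ 3 * (2 ^ Fintype.card ι * ∑ k, (‖c k‖ ^ 2 + M * ‖w k‖ ^ 2) * resolvLoss Φ σ A (s k)) := by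
  have h := hσ.isHermitian
  have hτ := hΦ.map_posSemidef hσ
  have hB := hA.map hΦ hσ hA'
  have hB' := hΦ.map_isHermitian hA'
  set u : ℝ → ℂ := fun x => ∑ k, w k * ((1 / (s k + x) : ℝ) : ℂ) with hu
  set S₁ := opPow σ (1 / 2 - Complex.I * t) with hS₁
  set S₂ := opPow σ (1 / 2 + Complex.I * t) with hS₂
  have hc₁ : S₁ᴴ = S₂ := by
    rw [hS₁, opPow_conjTranspose hσ]
    congr 1
    simp
  have hc₂ : S₂ᴴ = S₁ := by rw [← hc₁, Matrix.conjTranspose_conjTranspose]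
  have h22 : S₂ * S₁ = σ := by
    rw [hS₁, hS₂, opPow_mul h]
    convert opPow_one h using 2
    ring
  set X : ι → Op n := fun k => resolv h (s k) A
  set Y : ι → Op m := fun k => resolv hτ.isHermitian (s k) (Φ A)
  -- The output error `u * G` is cut at `x = 1`: the part `Z₀` will be measured in the left weighted
  -- norm and `Z₁` in the right one, the choices for which the growth of `G` can be absorbed.
  set Z₀ := modFun hτ.isHermitian (fun x => if x ≤ 1 then u x * G x else 0) (Φ A) with hZ₀
  set Z₁ := modFun hτ.isHermitian (fun x => if x ≤ 1 then 0 else u x * G x) (Φ A) with hZ₁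
  have hXs : ∀ b : ι → ℂ, ∑ k, b k • X k
      = modFun h (fun x => ∑ k, b k * ((1 / (s k + x) : ℝ) : ℂ)) A := fun b =>
    (modFun_sum h Finset.univ b (fun k x => ((1 / (s k + x) : ℝ) : ℂ)) A).symm
  have hYs : ∀ b : ι → ℂ, ∑ k, b k • Y k
      = modFun hτ.isHermitian (fun x => ∑ k, b k * ((1 / (s k + x) : ℝ) : ℂ)) (Φ A) := fun b =>
    (modFun_sum _ Finset.univ b (fun k x => ((1 / (s k + x) : ℝ) : ℂ)) _).symm
  have hX : modFun h (rotFun t) A = ∑ k, c k • X k := by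
    rw [hXs]
    refine modFun_congr h hA hA' fun i j hi hj => ?_
    have hi' : 0 < h.eigenvalues i := lt_of_le_of_ne (hσ.eigenvalues_nonneg i) hi.symm
    have hj' : 0 < h.eigenvalues j := lt_of_le_of_ne (hσ.eigenvalues_nonneg j) hj.symm
    rw [hf _ (by positivity), hw i j hi hj, zero_mul, add_zero]
  have hY : modFun hτ.isHermitian (rotFun t) (Φ A) = ∑ k, c k • Y k + (Z₀ + Z₁) := by
    rw [hYs, hZ₀, hZ₁, ← modFun_add, ← modFun_add]
    refine modFun_congr _ hB hB' fun i j hi hj => ?_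
    have hi' := lt_of_le_of_ne (hτ.eigenvalues_nonneg i) hi.symm
    have hj' := lt_of_le_of_ne (hτ.eigenvalues_nonneg j) hj.symm
    rw [hf _ (by positivity)]
    simp only [hu]
    congr 1
    split_ifs <;> simp
  have hXu : (0 : Op n) = ∑ k, w k • X k := by
    rw [hXs]
    have : (0 : Op n) = modFun h (fun _ => 0) A := by
      apply eigCoord_injective h
      ext i j
      rw [eigCoord_modFun]
      simp [eigCoord]
    rw [this]
    refine modFun_congr h hA hA' fun i j hi hj => ?_
    exact (hw i j hi hj).symm
  have hYu : modFun hτ.isHermitian u (Φ A) = ∑ k, w k • Y k := (hYs w).symm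
  have hloss : ∀ k, defect Φ σ (X k) (Y k) ≤ resolvLoss Φ σ A (s k) :=
    fun k => defect_resolv_le hΦ hσ hA hA' (hs k)
  have hdef : ∀ b : ι → ℂ, defect Φ σ (∑ k, b k • X k) (∑ k, b k • Y k)
      ≤ 2 ^ Fintype.card ι * ∑ k, ‖b k‖ ^ 2 * resolvLoss Φ σ A (s k) := fun b =>
    (defect_sum_le hΦ hσ Finset.univ b X Y).trans (by
      rw [Finset.card_univ]
      exact mul_le_mul_of_nonneg_left (Finset.sum_le_sum fun k _ =>
        mul_le_mul_of_nonneg_left (hloss k) (by positivity)) (by positivity))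
  set E := (∑ k, c k • X k) - hsAdjoint Φ (∑ k, c k • Y k) with hE
  have hdec : A - rotatedPetz σ Φ t (Φ A)
      = S₁ * E * S₂ - S₁ * hsAdjoint Φ Z₀ * S₂ - S₁ * (hsAdjoint Φ Z₁ * S₂) := by
    have hAeq := opPow_mul_modFun_mul_opPow hσ hA hA' t
    rw [hX] at hAeq
    rw [rotatedPetz, opPow_mul_mul_opPow hτ hB hB', hY, hsAdjoint_add, hsAdjoint_add, hE]
    conv_lhs => lhs; rw [← hAeq]
    simp only [mul_add, mul_sub, add_mul, sub_mul, mul_assoc]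
    abel
  obtain ⟨W, hW, hWc⟩ := exists_contraction_traceNorm (A - rotatedPetz σ Φ t (Φ A))
  have hσtr : (S₁ᴴ * S₁).trace.re = 1 := by rw [hc₁, h22, htr]; rfl
  have hσtr' : (S₂ * S₂ᴴ).trace.re = 1 := by rw [hc₂, h22, htr]; rfl
  -- Each term of `hdec` is split into two Hilbert–Schmidt factors, one of them a bare `S₁` or `S₂`
  -- of norm one because `tr σ = 1`. For the third term the bare factor is on the left, which leaves
  -- `Φ†(Z₁)` in the right weighted norm.
  have b1 := trace_contraction_re_sq_le hWc (S₁ * E) S₂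
  have b2 := trace_contraction_re_sq_le hWc (S₁ * hsAdjoint Φ Z₀) S₂
  have b3 := trace_contraction_re_sq_le hWc S₁ (hsAdjoint Φ Z₁ * S₂)
  have e1 : ∀ Q : Op n, (S₁ * Q)ᴴ * (S₁ * Q) = Qᴴ * σ * Q := fun Q => by
    rw [Matrix.conjTranspose_mul, hc₁, ← h22]; simp only [mul_assoc]
  have e2 : ∀ Q : Op n, (Q * S₂) * (Q * S₂)ᴴ = Q * σ * Qᴴ := fun Q => by
    rw [Matrix.conjTranspose_mul, hc₂, ← h22]; simp only [mul_assoc]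
  rw [e1, hσtr', mul_one] at b1 b2
  rw [e2, hσtr, one_mul] at b3
  have c1 : (Eᴴ * σ * E).trace.re ≤ defect Φ σ (∑ k, c k • X k) (∑ k, c k • Y k) :=
    (trace_conj_sub_le_defectL hΦ hσ _ _).trans
      (le_add_of_nonneg_right (defectR_nonneg hΦ hσ _ _))
  have c2 := (trace_hsAdjoint_left_le hΦ hσ Z₀).trans
    (trace_modFun_mul_left_le hτ hB hB' (φ := u) hM hG0)
  have c3 := (trace_hsAdjoint_right_le hΦ hσ Z₁).trans
    (trace_modFun_mul_right_le hτ hB hB' (φ := u) hM hG1)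
  -- Since `∑ wₖ Xₖ = 0`, the defect at the weights `w` consists only of the left and right norms of
  -- the output operator of `u`.
  have c4 : (modFun hτ.isHermitian u (Φ A) * Φ σ * (modFun hτ.isHermitian u (Φ A))ᴴ).trace.re +
      ((modFun hτ.isHermitian u (Φ A))ᴴ * Φ σ * modFun hτ.isHermitian u (Φ A)).trace.re
      = defect Φ σ (∑ k, w k • X k) (∑ k, w k • Y k) := by
    rw [← hXu, ← hYu]
    simp [defect, defectL, defectR]
    ring
  have hsum : ∑ k, (‖c k‖ ^ 2 + M * ‖w k‖ ^ 2) * resolvLoss Φ σ A (s k)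
      = ∑ k, ‖c k‖ ^ 2 * resolvLoss Φ σ A (s k) +
        M * ∑ k, ‖w k‖ ^ 2 * resolvLoss Φ σ A (s k) := by
    rw [Finset.mul_sum, ← Finset.sum_add_distrib]
    exact Finset.sum_congr rfl fun k _ => by ring
  have d1 := hdef c
  have d2 := mul_le_mul_of_nonneg_left (hdef w) hM
  rw [← c4] at d2
  rw [hW, hdec, hsum]
  simp only [mul_sub, Matrix.trace_sub, Complex.sub_re]
  simp only [← mul_assoc] at b1 b2 b3 ⊢
  set x := (W * S₁ * E * S₂).trace.re
  set y := (W * S₁ * hsAdjoint Φ Z₀ * S₂).trace.re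
  set z := (W * S₁ * hsAdjoint Φ Z₁ * S₂).trace.re
  have : (x - y - z) ^ 2 ≤ 3 * (x ^ 2 + y ^ 2 + z ^ 2) := by
    nlinarith [sq_nonneg (x + y), sq_nonneg (x + z), sq_nonneg (y - z)]
  simp only [← mul_assoc] at c1 c2 c3 d1 d2
  nlinarith

end Recovery

/-! ### Newton interpolation on the right half plane and partial fractions. -/

section Interpolation

/-- Away from the node, `‖z - a‖` is comparable to `1 + ‖z‖`, so division by `z - a` lowers the
growth by one power. -/
theorem norm_sub_ge {z : ℂ} {l a : ℝ} (hl : 0 < l) (ha : l ≤ a) (ha' : a ≤ l⁻¹)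
    (hz : l / 2 ≤ ‖z - a‖) : 1 + ‖z‖ ≤ (2 * (1 + l⁻¹) / l + 1) * ‖z - a‖ := by
  have h1 : ‖z‖ ≤ ‖z - a‖ + l⁻¹ := by
    calc ‖z‖ = ‖(z - a) + a‖ := by ring_nf
      _ ≤ ‖z - a‖ + ‖(a : ℂ)‖ := norm_add_le _ _
      _ ≤ _ := by
        rw [Complex.norm_real, Real.norm_of_nonneg (hl.le.trans ha)]
        linarith
  have h2 : 1 + l⁻¹ ≤ 2 * (1 + l⁻¹) / l * ‖z - a‖ := by
    calc 1 + l⁻¹ = 2 * (1 + l⁻¹) / l * (l / 2) := by field_simp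
      _ ≤ _ := mul_le_mul_of_nonneg_left hz (by positivity)
  linarith

/-- Divided differences on the right half plane lower the growth at infinity by one. -/
theorem exists_norm_dslope_le {l : ℝ} (hl : 0 < l) (hl1 : l ≤ 1) (k : ℕ) :
    ∃ K : ℝ, 0 ≤ K ∧ ∀ (F : ℂ → ℂ) (C a : ℝ), DifferentiableOn ℂ F {z | 0 < z.re} → 0 ≤ C →
      (∀ z : ℂ, 0 < z.re → ‖F z‖ ≤ C * ((1 + ‖z‖) ^ (k + 1) / Real.sqrt ‖z‖)) →
      l ≤ a → a ≤ l⁻¹ →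
      DifferentiableOn ℂ (dslope F a) {z | 0 < z.re} ∧ ‖F a‖ ≤ K * C ∧
      ∀ z : ℂ, 0 < z.re → ‖dslope F a z‖ ≤ K * C * ((1 + ‖z‖) ^ k / Real.sqrt ‖z‖) := by
  -- `B` bounds the growth weight on the disc of radius `l / 2` about a node, where `l / 2 ≤ ‖z‖ ≤ 2
  -- / l`.
  set B : ℝ := (1 + 2 * l⁻¹) ^ (k + 1) / Real.sqrt (l / 2) with hB
  set K₁ : ℝ := 2 * (1 + l⁻¹) / l + 1 with hK₁
  have hB0 : 0 ≤ B := by positivity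
  have hK0 : 0 ≤ K₁ := by positivity
  have hl' : 1 ≤ l⁻¹ := (one_le_inv₀ hl).2 hl1
  refine ⟨K₁ + B * K₁ + 4 * B * Real.sqrt (2 * l⁻¹) / l + B, by positivity, ?_⟩
  intro F C a hF hC hbd ha ha'
  have ha0 : 0 < a := hl.trans_le ha
  have hopen : IsOpen {z : ℂ | 0 < z.re} := isOpen_lt continuous_const Complex.continuous_re
  have hna : ‖(a : ℂ)‖ = a := by rw [Complex.norm_real, Real.norm_of_nonneg ha0.le]
  have hball : ∀ z ∈ Metric.ball (a : ℂ) (l / 2),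
      0 < z.re ∧ l / 2 ≤ ‖z‖ ∧ ‖z‖ ≤ 2 * l⁻¹ := by
    intro z hz
    rw [Metric.mem_ball, dist_eq_norm] at hz
    have h1 : |(z - a).re| ≤ ‖z - a‖ := Complex.abs_re_le_norm _
    rw [Complex.sub_re, Complex.ofReal_re] at h1
    have h2 := (abs_le.1 h1).1
    have h3 : l / 2 ≤ z.re := by linarith
    refine ⟨by linarith, h3.trans (Complex.re_le_norm z), ?_⟩
    calc ‖z‖ = ‖(z - a) + a‖ := by ring_nf
      _ ≤ ‖z - a‖ + ‖(a : ℂ)‖ := norm_add_le _ _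
      _ ≤ _ := by rw [hna]; linarith
  have hFball : ∀ z ∈ Metric.ball (a : ℂ) (l / 2), ‖F z‖ ≤ C * B := by
    intro z hz
    obtain ⟨h1, h2, h3⟩ := hball z hz
    refine (hbd z h1).trans (mul_le_mul_of_nonneg_left ?_ hC)
    rw [hB]
    gcongr
  have hcen : (a : ℂ) ∈ Metric.ball (a : ℂ) (l / 2) := Metric.mem_ball_self (by positivity)
  have hFa : ‖F a‖ ≤ C * B := hFball _ hcen
  refine ⟨(Complex.differentiableOn_dslope (hopen.mem_nhds (by simpa using ha0))).2 hF,
    hFa.trans ?_, ?_⟩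
  · have : 0 ≤ (K₁ + B * K₁ + 4 * B * Real.sqrt (2 * l⁻¹) / l) * C := by positivity
    linarith
  intro z hz
  have hz0 : 0 < ‖z‖ := hz.trans_le (Complex.re_le_norm z)
  have hsq : 0 < Real.sqrt ‖z‖ := Real.sqrt_pos.2 hz0
  set Wt : ℝ := (1 + ‖z‖) ^ k / Real.sqrt ‖z‖ with hWt
  have hWt0 : 0 ≤ Wt := by positivity
  -- Near the node a Schwarz lemma bounds the divided difference by the oscillation of `F` on the
  -- disc; elsewhere numerator and denominator are estimated separately.
  by_cases hzb : z ∈ Metric.ball (a : ℂ) (l / 2)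
  · obtain ⟨-, -, h3⟩ := hball z hzb
    have hs : ‖dslope F a z‖ ≤ (2 * (C * B)) / (l / 2) := by
      refine Complex.norm_dslope_le_div_of_mapsTo_ball
        (hF.mono fun y hy => (hball y hy).1) (fun y hy => ?_) hzb
      rw [Metric.mem_closedBall, dist_eq_norm]
      exact (norm_sub_le _ _).trans (by linarith [hFball y hy])
    have hw : 1 ≤ Real.sqrt (2 * l⁻¹) * Wt := by
      rw [hWt, ← mul_div_assoc, le_div_iff₀ hsq, one_mul]
      calc Real.sqrt ‖z‖ ≤ Real.sqrt (2 * l⁻¹) := Real.sqrt_le_sqrt h3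
        _ ≤ Real.sqrt (2 * l⁻¹) * (1 + ‖z‖) ^ k :=
          le_mul_of_one_le_right (Real.sqrt_nonneg _) (one_le_pow₀ (by linarith))
    calc ‖dslope F a z‖ ≤ (2 * (C * B)) / (l / 2) := hs
      _ = (4 * B / l * C) * 1 := by field_simp; ring
      _ ≤ (4 * B / l * C) * (Real.sqrt (2 * l⁻¹) * Wt) :=
        mul_le_mul_of_nonneg_left hw (by positivity)
      _ = (4 * B * Real.sqrt (2 * l⁻¹) / l) * C * Wt := by ring
      _ ≤ _ := by
        have : 0 ≤ (K₁ + B * K₁ + B) * C * Wt := by positivity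
        linarith
  · rw [Metric.mem_ball, dist_eq_norm, not_lt] at hzb
    have hd : 0 < ‖z - a‖ := lt_of_lt_of_le (by positivity) hzb
    have hne : z ≠ a := fun h => by simp [h] at hd
    have hge := norm_sub_ge hl ha ha' hzb
    rw [dslope_of_ne _ hne, slope_def_module, norm_smul, norm_inv]
    have h1 : ‖F z‖ ≤ K₁ * C * Wt * ‖z - a‖ := by
      calc ‖F z‖ ≤ C * ((1 + ‖z‖) ^ (k + 1) / Real.sqrt ‖z‖) := hbd z hz
        _ = C * Wt * (1 + ‖z‖) := by rw [hWt]; ring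
        _ ≤ C * Wt * (K₁ * ‖z - a‖) := mul_le_mul_of_nonneg_left hge (by positivity)
        _ = _ := by ring
    have h2 : ‖F a‖ ≤ B * K₁ * C * Wt * ‖z - a‖ := by
      have hw : 1 ≤ (1 + ‖z‖) * Wt := by
        rw [hWt, ← mul_div_assoc, le_div_iff₀ hsq, one_mul]
        have h4 : Real.sqrt ‖z‖ ≤ 1 + ‖z‖ := by
          rw [Real.sqrt_le_left (by positivity)]
          nlinarith
        exact h4.trans (le_mul_of_one_le_right (by positivity) (one_le_pow₀ (by linarith)))
      calc ‖F a‖ ≤ C * B * 1 := by linarith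
        _ ≤ C * B * ((1 + ‖z‖) * Wt) := mul_le_mul_of_nonneg_left hw (by positivity)
        _ = C * B * Wt * (1 + ‖z‖) := by ring
        _ ≤ C * B * Wt * (K₁ * ‖z - a‖) := mul_le_mul_of_nonneg_left hge (by positivity)
        _ = _ := by ring
    rw [inv_mul_le_iff₀ hd]
    have h3 : 0 ≤ (4 * B * Real.sqrt (2 * l⁻¹) / l + B) * C * Wt * ‖z - a‖ := by positivity
    have h4 := norm_sub_le (F z) (F a)
    linarith

open Polynomial in
/-- Newton interpolation on the right half plane with quantitative remainder. -/
theorem exists_newton {l : ℝ} (hl : 0 < l) (hl1 : l ≤ 1) {S : ℝ} (hS : 0 ≤ S) (N : ℕ) :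
    ∃ K : ℝ, 0 ≤ K ∧ ∀ (F : ℂ → ℂ) (C : ℝ) (r : List ℝ), DifferentiableOn ℂ F {z | 0 < z.re} →
      0 ≤ C → (∀ z : ℂ, 0 < z.re → ‖F z‖ ≤ C * ((1 + ‖z‖) ^ (N + 1) / Real.sqrt ‖z‖)) →
      r.length = N → (∀ a ∈ r, l ≤ a ∧ a ≤ l⁻¹) →
      ∃ (P : ℂ[X]) (G : ℂ → ℂ), P.degree < N ∧
        (∀ s : ℝ, 0 ≤ s → s ≤ S → ‖P.eval (-(s : ℂ))‖ ≤ K * C) ∧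
        (∀ z : ℂ, 0 < z.re → ‖G z‖ ≤ K * C * ((1 + ‖z‖) ^ 1 / Real.sqrt ‖z‖)) ∧
        ∀ z : ℂ, 0 < z.re → F z = P.eval z + (r.map fun a : ℝ => z - (a : ℂ)).prod * G z := by
  induction N with
  | zero =>
    refine ⟨1, zero_le_one, fun F C r _ hC hb hr _ => ⟨0, F, ?_, ?_, ?_, ?_⟩⟩
    · simp
    · intro s _ _; simpa using hC
    · intro z hz; simpa using hb z hz
    · intro z _
      rw [List.length_eq_zero_iff.1 hr]; simp
  | succ N ih =>
    obtain ⟨K₁, hK₁, h1⟩ := exists_norm_dslope_le hl hl1 (N + 1)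
    obtain ⟨K₂, hK₂, h2⟩ := ih
    refine ⟨K₁ + (S + l⁻¹) * (K₂ * K₁) + K₂ * K₁, by positivity, ?_⟩
    intro F C r hF hC hb hr hmem
    obtain ⟨a, r, rfl⟩ := List.exists_cons_of_length_eq_add_one hr
    have ha := hmem a (by simp)
    obtain ⟨d1, d2, d3⟩ := h1 F C a hF hC hb ha.1 ha.2
    obtain ⟨P, G, e1, e2, e3, e4⟩ := h2 (dslope F a) (K₁ * C) r d1 (by positivity) d3
      (by simpa using hr) (fun b hb => hmem b (by simp [hb]))
    -- One Newton step: interpolate the divided difference at the remaining nodes. It stays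
    -- holomorphic at `a`, so repeated nodes are harmless.
    refine ⟨Polynomial.C (F a) + (X - Polynomial.C (a : ℂ)) * P, G, ?_, ?_, ?_, ?_⟩
    · refine (degree_add_le _ _).trans_lt (max_lt (degree_C_le.trans_lt ?_) ?_)
      · exact_mod_cast Nat.succ_pos N
      · rw [degree_mul, degree_X_sub_C]
        by_cases hP : P = 0
        · simp only [hP, degree_zero]
          exact WithBot.bot_lt_coe (N + 1)
        · rw [degree_eq_natDegree hP] at e1 ⊢
          have : P.natDegree < N := by exact_mod_cast e1
          have : 1 + P.natDegree < N + 1 := by omega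
          exact_mod_cast this
    · intro s hs hs'
      have h5 : ‖-(s : ℂ) - a‖ ≤ S + l⁻¹ := by
        rw [← Complex.ofReal_neg, ← Complex.ofReal_sub, Complex.norm_real, Real.norm_eq_abs,
          abs_le]
        constructor <;> linarith [ha.1, ha.2]
      simp only [eval_add, eval_mul, eval_sub, eval_X, eval_C]
      calc _ ≤ ‖F a‖ + ‖-(s : ℂ) - a‖ * ‖P.eval (-(s : ℂ))‖ := by
            rw [← norm_mul]; exact norm_add_le _ _
        _ ≤ K₁ * C + (S + l⁻¹) * (K₂ * (K₁ * C)) := by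
            gcongr
            exact e2 s hs hs'
        _ ≤ _ := by
            have : 0 ≤ K₂ * K₁ * C := by positivity
            linarith
    · intro z hz
      refine (e3 z hz).trans (mul_le_mul_of_nonneg_right ?_ (by positivity))
      have : 0 ≤ (K₁ + (S + l⁻¹) * (K₂ * K₁)) * C := by positivity
      linarith
    · intro z hz
      have h6 : F z = F a + (z - a) * dslope F a z := by
        have := sub_smul_dslope F (a : ℂ) z
        rw [smul_eq_mul] at this
        rw [this]; ring
      rw [h6, e4 z hz]
      simp only [eval_add, eval_mul, eval_sub, eval_X, eval_C, List.map_cons, List.prod_cons]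
      ring

open Polynomial in
/-- Partial fraction decomposition at separated nodes. -/
theorem exists_partialFraction {ι : Type*} [Fintype ι] [DecidableEq ι] {s : ι → ℝ}
    (hsep : ∀ i j, i ≠ j → 1 ≤ |s i - s j|) {P : ℂ[X]} (hP : P.degree < Fintype.card ι) :
    ∃ c : ι → ℂ, (∀ k, ‖c k‖ ≤ ‖P.eval (-(s k : ℂ))‖) ∧
      ∀ x : ℝ, (∀ k, s k + x ≠ 0) →
        P.eval (x : ℂ) / ∏ k, ((s k : ℂ) + x) = ∑ k, c k * ((1 / (s k + x) : ℝ) : ℂ) := by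
  have hinj : Set.InjOn (fun k => -(s k : ℂ)) (Finset.univ : Finset ι) := by
    intro i _ j _ hij
    by_contra hne
    have h1 := hsep i j hne
    have h2 : s i = s j := by exact_mod_cast neg_injective hij
    rw [h2] at h1; norm_num at h1
  have hL := Lagrange.eq_interpolate hinj (by simpa using hP)
  refine ⟨fun k => P.eval (-(s k : ℂ)) * ∏ j ∈ Finset.univ.erase k, (-(s k : ℂ) - -(s j : ℂ))⁻¹,
    fun k => ?_, fun x hx => ?_⟩
  · rw [norm_mul]
    -- Nodes at mutual distance at least one make every Lagrange denominator at least one in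
    -- modulus.
    refine mul_le_of_le_one_right (norm_nonneg _) ?_
    rw [norm_prod]
    refine Finset.prod_le_one (fun _ _ => norm_nonneg _) fun j hj => ?_
    rw [norm_inv]
    apply inv_le_one_of_one_le₀
    have := hsep j k (Finset.ne_of_mem_erase hj)
    rw [show -(s k : ℂ) - -(s j : ℂ) = ((s j - s k : ℝ) : ℂ) by push_cast; ring,
      Complex.norm_real, Real.norm_eq_abs]
    exact this
  · conv_lhs => rw [hL]
    have hne : ∀ k, (s k : ℂ) + x ≠ 0 := fun k => by exact_mod_cast hx k
    rw [Lagrange.interpolate_apply, eval_finsetSum, Finset.sum_div]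
    refine Finset.sum_congr rfl fun k _ => ?_
    rw [eval_mul, eval_C, Lagrange.basis, eval_prod, ← Finset.mul_prod_erase _ _ (Finset.mem_univ k)]
    simp only [Lagrange.basisDivisor, eval_mul, eval_C, eval_sub, eval_X, Finset.prod_mul_distrib]
    have h0 : ∏ j ∈ Finset.univ.erase k, ((s j : ℂ) + x) ≠ 0 :=
      Finset.prod_ne_zero_iff.2 fun j _ => hne j
    have h1 : ∏ j ∈ Finset.univ.erase k, ((x : ℂ) - -(s j : ℂ))
        = ∏ j ∈ Finset.univ.erase k, ((s j : ℂ) + x) :=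
      Finset.prod_congr rfl fun j _ => by ring
    rw [h1]
    push_cast
    have := hne k
    field_simp

/-- On the right half plane `|arg z| ≤ π / 2`; this is the origin of the `cosh (π t)` in the
theorem. -/
theorem norm_cpow_rot_le {z : ℂ} (hz : 0 < z.re) (t : ℝ) :
    ‖z ^ (-1 / 2 + Complex.I * t)‖ ≤ Real.exp (Real.pi * |t| / 2) / Real.sqrt ‖z‖ := by
  have hz0 : z ≠ 0 := fun h => by simp [h] at hz
  have hre : (-1 / 2 + Complex.I * t : ℂ).re = -(1 / 2) := by simp; norm_num
  have him : (-1 / 2 + Complex.I * t : ℂ).im = t := by simp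
  rw [Complex.norm_cpow_of_ne_zero hz0, hre, him, Real.rpow_neg (norm_nonneg z),
    ← Real.sqrt_eq_rpow, div_eq_mul_inv, ← Real.exp_neg, mul_comm, div_eq_mul_inv]
  refine mul_le_mul_of_nonneg_right (Real.exp_le_exp.2 ?_) (by positivity)
  have h1 : |z.arg| ≤ Real.pi / 2 := Complex.abs_arg_le_pi_div_two_iff.2 hz.le
  calc -(z.arg * t) ≤ |z.arg * t| := neg_le_abs _
    _ = |z.arg| * |t| := abs_mul _ _
    _ ≤ Real.pi / 2 * |t| := mul_le_mul_of_nonneg_right h1 (abs_nonneg t)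
    _ = _ := by ring

open Polynomial in
/-- Uniform interpolation of `x ^ (-1/2 + it)` by `N + 1` resolvents. -/
theorem exists_interpolation {l : ℝ} (hl : 0 < l) (hl1 : l ≤ 1) (N : ℕ) :
    ∃ K : ℝ, 0 ≤ K ∧ ∀ (t : ℝ) (s : Fin (N + 1) → ℝ) (r : List ℝ),
      (∀ k : Fin (N + 1), 2 * ((k : ℕ) : ℝ) + 1 ≤ s k ∧ s k ≤ 2 * ((k : ℕ) : ℝ) + 2) → r.length = N →
      (∀ a ∈ r, l ≤ a ∧ a ≤ l⁻¹) →
      ∃ (c w : Fin (N + 1) → ℂ) (G : ℝ → ℂ),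
        (∀ k, ‖c k‖ ^ 2 ≤ K * Real.exp (Real.pi * |t|)) ∧ (∀ k, ‖w k‖ ^ 2 ≤ K) ∧
        (∀ a ∈ r, ∑ k, w k * ((1 / (s k + a) : ℝ) : ℂ) = 0) ∧
        (∀ x : ℝ, 0 < x → rotFun t x = ∑ k, c k * ((1 / (s k + x) : ℝ) : ℂ)
          + (∑ k, w k * ((1 / (s k + x) : ℝ) : ℂ)) * G x) ∧
        (∀ x : ℝ, 0 < x → x ≤ 1 → ‖G x‖ ^ 2 ≤ K * Real.exp (Real.pi * |t|) * x⁻¹) ∧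
        ∀ x : ℝ, 1 ≤ x → ‖G x‖ ^ 2 ≤ K * Real.exp (Real.pi * |t|) * x := by
  set S : ℝ := 2 * N + 2 with hS
  have hS1 : 1 ≤ S := by have : (0 : ℝ) ≤ N := by positivity
                         linarith
  obtain ⟨K₁, hK₁, hNew⟩ := exists_newton hl hl1 (zero_le_one.trans hS1) N
  set D : ℝ := K₁ * S ^ (N + 1) with hD
  have hD0 : 0 ≤ D := by positivity
  -- The first summand serves `c` and `G`, the `4` coming from `(1 + x)² ≤ 4` for `x ≤ 1` and `(1 +
  -- x)² ≤ 4x²` for `x ≥ 1`. The second serves `w`.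
  refine ⟨4 * D ^ 2 + ((S + l⁻¹) ^ N) ^ 2, by positivity, ?_⟩
  intro t s r hs hr hmem
  set C : ℝ := Real.exp (Real.pi * |t| / 2) * S ^ (N + 1) with hC
  have hC0 : 0 ≤ C := by positivity
  have hCsq : (K₁ * C) ^ 2 = D ^ 2 * Real.exp (Real.pi * |t|) := by
    rw [hC, hD, show Real.pi * |t| = Real.pi * |t| / 2 + Real.pi * |t| / 2 by ring, Real.exp_add]
    ring_nf
  have hs1 : ∀ k, 1 ≤ s k := fun k => by
    have h1 := (hs k).1
    have : (0 : ℝ) ≤ (k : ℕ) := by positivity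
    linarith
  have hsS : ∀ k, s k ≤ S := fun k => by
    have h1 := (hs k).2
    have : ((k : ℕ) : ℝ) ≤ N := by exact_mod_cast Nat.lt_succ_iff.1 k.2
    linarith
  have hsep : ∀ i j, i ≠ j → 1 ≤ |s i - s j| := by
    have key : ∀ i j : Fin (N + 1), i < j → 1 ≤ |s i - s j| := by
      intro i j hij
      have h1 : ((i : ℕ) : ℝ) + 1 ≤ (j : ℕ) := by exact_mod_cast hij
      rw [abs_sub_comm]
      exact le_trans (by linarith [(hs i).2, (hs j).1]) (le_abs_self _)
    intro i j hij
    rcases lt_or_gt_of_ne hij with h | h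
    · exact key i j h
    · rw [abs_sub_comm]; exact key j i h
  -- Clearing the denominators of the resolvents turns the task into polynomial interpolation. The
  -- growth exponent of `F` is `N + 1/2`, and `N` divided differences leave `G` with growth `(1 +
  -- ‖z‖) / √‖z‖`.
  set F : ℂ → ℂ := fun z => z ^ (-1 / 2 + Complex.I * t) * ∏ k, ((s k : ℂ) + z) with hFdef
  have hFdiff : DifferentiableOn ℂ F {z | 0 < z.re} := by
    intro z hz
    have h1 : DifferentiableAt ℂ (fun z : ℂ => z ^ (-1 / 2 + Complex.I * t)) z :=
      differentiableAt_id.cpow_const (Or.inl hz)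
    have h2 : DifferentiableAt ℂ (fun z : ℂ => ∏ k, ((s k : ℂ) + z)) z := by fun_prop
    exact (h1.mul h2).differentiableWithinAt
  have hFb : ∀ z : ℂ, 0 < z.re → ‖F z‖ ≤ C * ((1 + ‖z‖) ^ (N + 1) / Real.sqrt ‖z‖) := by
    intro z hz
    have h1 : ‖∏ k, ((s k : ℂ) + z)‖ ≤ (S * (1 + ‖z‖)) ^ (N + 1) := by
      rw [norm_prod]
      calc _ ≤ ∏ _k : Fin (N + 1), S * (1 + ‖z‖) := by
            refine Finset.prod_le_prod (fun _ _ => norm_nonneg _) fun k _ => ?_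
            refine (norm_add_le _ _).trans ?_
            rw [Complex.norm_real, Real.norm_of_nonneg (zero_le_one.trans (hs1 k))]
            nlinarith [hsS k, norm_nonneg z]
        _ = _ := by simp
    calc ‖F z‖ = ‖z ^ (-1 / 2 + Complex.I * t)‖ * ‖∏ k, ((s k : ℂ) + z)‖ := norm_mul _ _
      _ ≤ (Real.exp (Real.pi * |t| / 2) / Real.sqrt ‖z‖) * (S * (1 + ‖z‖)) ^ (N + 1) :=
        mul_le_mul (norm_cpow_rot_le hz t) h1 (norm_nonneg _) (by positivity)
      _ = _ := by rw [hC, mul_pow]; ring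
  obtain ⟨P, G, hdeg, hPb, hGb, hFG⟩ := hNew F C r hFdiff hC0 hFb hr hmem
  obtain ⟨c, hc, hcP⟩ := exists_partialFraction (P := P) hsep (by
    rw [Fintype.card_fin]
    exact hdeg.trans (by exact_mod_cast Nat.lt_succ_self N))
  -- The nodal polynomial; divided by `∏ (sₖ + x)` it becomes the function `u` with coefficients
  -- `w`. Having one more resolvent than nodes makes its degree admissible for partial fractions.
  set p : ℂ[X] := (r.map fun a : ℝ => X - Polynomial.C (a : ℂ)).prod with hp
  have hpdeg : p.degree = N := by
    rw [hp, ← hr]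
    clear * -
    induction r with
    | nil => simp
    | cons a r ih =>
      rw [List.map_cons, List.prod_cons, degree_mul, ih, degree_X_sub_C, List.length_cons]
      push_cast
      rw [add_comm]
  have hpeval : ∀ z : ℂ, p.eval z = (r.map fun a : ℝ => z - (a : ℂ)).prod := by
    intro z
    rw [hp, eval_list_prod, List.map_map]
    congr 1
    refine List.map_congr_left fun a _ => ?_
    simp
  obtain ⟨w, hw, hwP⟩ := exists_partialFraction (P := p) hsep (by
    rw [hpdeg, Fintype.card_fin]
    exact_mod_cast Nat.lt_succ_self N)
  have hpb : ∀ k, ‖p.eval (-(s k : ℂ))‖ ≤ (S + l⁻¹) ^ N := by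
    intro k
    rw [hpeval, ← hr]
    clear hpeval hp hpdeg hwP hw hFG hr
    induction r with
    | nil => simp
    | cons a r ih =>
      rw [List.map_cons, List.prod_cons, norm_mul, List.length_cons, pow_succ, mul_comm]
      have ha := hmem a (by simp)
      refine mul_le_mul (ih fun b hb => hmem b (by simp [hb])) ?_ (norm_nonneg _) (by positivity)
      rw [← Complex.ofReal_neg, ← Complex.ofReal_sub, Complex.norm_real, Real.norm_eq_abs,
          abs_le]
      constructor <;> linarith [ha.1, ha.2, hs1 k, hsS k]
  have hexp : 0 < Real.exp (Real.pi * |t|) := Real.exp_pos _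
  refine ⟨c, w, fun x => G x, ?_, ?_, ?_, ?_, ?_, ?_⟩
  · intro k
    have h1 : ‖c k‖ ≤ K₁ * C := (hc k).trans (hPb (s k) (zero_le_one.trans (hs1 k)) (hsS k))
    calc ‖c k‖ ^ 2 ≤ (K₁ * C) ^ 2 := by gcongr
      _ = D ^ 2 * Real.exp (Real.pi * |t|) := hCsq
      _ ≤ _ := by
        refine mul_le_mul_of_nonneg_right ?_ hexp.le
        nlinarith [sq_nonneg D, sq_nonneg ((S + l⁻¹) ^ N)]
  · intro k
    have h1 := (hw k).trans (hpb k)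
    calc ‖w k‖ ^ 2 ≤ ((S + l⁻¹) ^ N) ^ 2 := by gcongr
      _ ≤ _ := by nlinarith [sq_nonneg D]
  · intro a ha
    have ha0 : 0 < a := hl.trans_le (hmem a ha).1
    rw [← hwP a fun k => by linarith [hs1 k], hpeval]
    have : (r.map fun b : ℝ => (a : ℂ) - (b : ℂ)).prod = 0 :=
      List.prod_eq_zero (List.mem_map.2 ⟨a, ha, sub_self _⟩)
    rw [this, zero_div]
  · intro x hx
    have hne : ∏ k, ((s k : ℂ) + x) ≠ 0 := Finset.prod_ne_zero_iff.2 fun k _ => by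
      have : s k + x ≠ 0 := by linarith [hs1 k]
      exact_mod_cast this
    rw [← hcP x fun k => by linarith [hs1 k], ← hwP x fun k => by linarith [hs1 k], hpeval]
    have h1 := hFG x (by simpa using hx)
    have h2 : rotFun t x = F x / ∏ k, ((s k : ℂ) + x) := by
      rw [hFdef, rotFun, mul_div_assoc, div_self hne, mul_one]
    rw [h2, h1]
    ring
  · intro x hx hx1
    have h1 := hGb x (by simpa using hx)
    rw [Complex.norm_real, Real.norm_of_nonneg hx.le, pow_one] at h1
    calc ‖G x‖ ^ 2 ≤ (K₁ * C * ((1 + x) / Real.sqrt x)) ^ 2 := by gcongr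
      _ = (K₁ * C) ^ 2 * (1 + x) ^ 2 * x⁻¹ := by
        rw [mul_pow, div_pow, Real.sq_sqrt hx.le]; ring
      _ ≤ (K₁ * C) ^ 2 * 4 * x⁻¹ := by
        gcongr
        nlinarith
      _ = 4 * D ^ 2 * Real.exp (Real.pi * |t|) * x⁻¹ := by rw [hCsq]; ring
      _ ≤ _ := by
        gcongr
        nlinarith [sq_nonneg ((S + l⁻¹) ^ N)]
  · intro x hx1
    have hx : 0 < x := by linarith
    have h1 := hGb x (by simpa using hx)
    rw [Complex.norm_real, Real.norm_of_nonneg hx.le, pow_one] at h1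
    calc ‖G x‖ ^ 2 ≤ (K₁ * C * ((1 + x) / Real.sqrt x)) ^ 2 := by gcongr
      _ = (K₁ * C) ^ 2 * ((1 + x) ^ 2 / x) := by
        rw [mul_pow, div_pow, Real.sq_sqrt hx.le]
      _ ≤ (K₁ * C) ^ 2 * (4 * x) := by
        gcongr
        rw [div_le_iff₀ hx]
        nlinarith
      _ = 4 * D ^ 2 * Real.exp (Real.pi * |t|) * x := by rw [hCsq]; ring
      _ ≤ _ := by
        gcongr
        nlinarith [sq_nonneg ((S + l⁻¹) ^ N)]

end Interpolation

/-! ### Approximate recovery with a dimension-dependent constant. -/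

section Quantitative

variable {n : Type u} [Fintype n] [DecidableEq n] {m : Type v} [Fintype m] [DecidableEq m]

theorem rotatedPetz_sub (σ : Op n) (Φ : Op n →ₗ[ℂ] Op m) (t : ℝ) (A B : Op m) :
    rotatedPetz σ Φ t (A - B) = rotatedPetz σ Φ t A - rotatedPetz σ Φ t B := by
  simp only [rotatedPetz, mul_sub, sub_mul, hsAdjoint_sub]

theorem mul_one_sub_opPow_zero {τ : Op n} (hτ : τ.IsHermitian) : τ * (1 - opPow τ 0) = 0 := by
  have := opPow_mul hτ 1 0
  rw [opPow_one hτ, add_zero, opPow_one hτ] at this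
  rw [mul_sub, mul_one, this, sub_self]

/-- The rotated Petz map recovers the reference state. -/
theorem rotatedPetz_map_self {Φ : Op n →ₗ[ℂ] Op m} (hΦ : IsChannel Φ) {σ : Op n}
    (hσ : σ.PosSemidef) (t : ℝ) : rotatedPetz σ Φ t (Φ σ) = σ := by
  have hτ := hΦ.map_posSemidef hσ
  have h1 : opPow (Φ σ) (-1 / 2 + Complex.I * t) * Φ σ * opPow (Φ σ) (-1 / 2 - Complex.I * t)
      = 1 - (1 - opPow (Φ σ) 0) := by
    conv_lhs => lhs; rhs; rw [← opPow_one hτ.isHermitian]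
    rw [opPow_mul hτ.isHermitian, opPow_mul hτ.isHermitian, sub_sub_cancel]
    congr 1
    ring
  -- `opPow (Φ σ) 0` is the support projection of `Φ(σ)`. The `σ`-weighted norm of the image under
  -- `Φ†` of its complement is at most the `Φ(σ)`-weighted norm of the complement, which is zero.
  have h2 : opPow σ (1 / 2 - Complex.I * t) * hsAdjoint Φ (1 - opPow (Φ σ) 0) = 0 := by
    rw [← Matrix.trace_conjTranspose_mul_self_eq_zero_iff]
    have e : (opPow σ (1 / 2 - Complex.I * t) * hsAdjoint Φ (1 - opPow (Φ σ) 0))ᴴ *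
        (opPow σ (1 / 2 - Complex.I * t) * hsAdjoint Φ (1 - opPow (Φ σ) 0))
        = (hsAdjoint Φ (1 - opPow (Φ σ) 0))ᴴ * σ * hsAdjoint Φ (1 - opPow (Φ σ) 0) := by
      rw [Matrix.conjTranspose_mul, opPow_conjTranspose hσ]
      have : opPow σ (star (1 / 2 - Complex.I * t)) * opPow σ (1 / 2 - Complex.I * t) = σ := by
        rw [opPow_mul hσ.isHermitian]
        convert opPow_one hσ.isHermitian using 2
        simp
        ring
      conv_rhs => lhs; rhs; rw [← this]
      simp only [mul_assoc]
    have h3 := trace_hsAdjoint_left_le hΦ hσ (1 - opPow (Φ σ) 0)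
    rw [mul_assoc _ (Φ σ), mul_one_sub_opPow_zero hτ.isHermitian, mul_zero, Matrix.trace_zero] at h3
    have h4 := (Matrix.posSemidef_conjTranspose_mul_self
      (opPow σ (1 / 2 - Complex.I * t) * hsAdjoint Φ (1 - opPow (Φ σ) 0))).trace_nonneg
    rw [e] at h4 ⊢
    exact Complex.ext (le_antisymm h3 (Complex.le_def.1 h4).1) (Complex.le_def.1 h4).2.symm
  rw [rotatedPetz, h1, hsAdjoint_sub, mul_sub, h2, hsAdjoint_one hΦ, mul_one, sub_zero,
    opPow_mul hσ.isHermitian]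
  convert opPow_one hσ.isHermitian using 2
  ring

theorem sum_eigenvalues_eq_one {σ : Op n} (hσ : IsState σ) :
    ∑ i, hσ.1.isHermitian.eigenvalues i = 1 := by
  have h2 : ((∑ i, hσ.1.isHermitian.eigenvalues i : ℝ) : ℂ) = 1 := by
    push_cast
    exact hσ.1.isHermitian.trace_eq_sum_eigenvalues.symm.trans hσ.2
  exact_mod_cast h2

theorem eigenvalues_le_one {σ : Op n} (hσ : IsState σ) (i : n) :
    hσ.1.isHermitian.eigenvalues i ≤ 1 := by
  rw [← sum_eigenvalues_eq_one hσ]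
  exact Finset.single_le_sum (fun j _ => hσ.1.eigenvalues_nonneg j) (Finset.mem_univ i)

/-- Padding with the harmless node `1` fixes the number of nodes at `N`, so that the interpolation
constant does not depend on the actual relative spectrum. -/
theorem exists_list_of_card_le {l : ℝ} {N : ℕ} (s : Finset ℝ) (hs : s.card ≤ N) (hl : l ≤ 1)
    (hl' : 1 ≤ l⁻¹) (h : ∀ a ∈ s, l ≤ a ∧ a ≤ l⁻¹) :
    ∃ r : List ℝ, r.length = N ∧ (∀ a ∈ r, l ≤ a ∧ a ≤ l⁻¹) ∧ ∀ a ∈ s, a ∈ r := by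
  refine ⟨s.toList ++ List.replicate (N - s.card) 1, ?_, ?_, ?_⟩
  · simp; omega
  · intro a ha
    rcases List.mem_append.1 ha with h1 | h1
    · exact h a (by simpa using h1)
    · rw [List.eq_of_mem_replicate h1]; exact ⟨hl, hl'⟩
  · intro a ha; simp [ha]

/-- Absolute continuity of Lebesgue measure gives the interval positive `ν`-mass, integrability of
`1 / (s + 1)` makes the mass finite, and some point has value at most the average. The constant is
chosen before `f`, hence depends only on `ν` and the interval. -/
theorem exists_node_le {ν : Measure ℝ} {a b : ℝ} (ha : 0 < a) (hab : a < b)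
    (hν : volume.restrict (Set.Ioi 0) ≪ ν) (hint : Integrable (fun s : ℝ => 1 / (s + 1)) ν) :
    ∃ κ : ℝ, 0 < κ ∧ ∀ f : ℝ → ℝ, Integrable f ν → 0 ≤ᵐ[ν] f →
      ∃ s ∈ Set.Icc a b, f s ≤ κ * ∫ x, f x ∂ν := by
  have h0 : ν (Set.Icc a b) ≠ 0 := by
    intro h
    have := hν h
    rw [Measure.restrict_apply measurableSet_Icc, Set.inter_eq_left.2, Real.volume_Icc,
      ENNReal.ofReal_eq_zero] at this
    · linarith
    · intro x hx; exact ha.trans_le hx.1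
  have h1 : ν (Set.Icc a b) ≠ ⊤ := by
    have hb : 0 < 1 / (b + 1) := by have : 0 < b := ha.trans hab
                                    positivity
    refine ((measure_mono ?_).trans_lt (hint.measure_norm_ge_lt_top hb)).ne
    intro x hx
    have : 0 < x := ha.trans_le hx.1
    rw [Set.mem_ofPred_eq, Real.norm_of_nonneg (by positivity)]
    exact one_div_le_one_div_of_le (by positivity) (by linarith [hx.2])
  refine ⟨(ν.real (Set.Icc a b))⁻¹, inv_pos.2 (ENNReal.toReal_pos h0 h1), fun f hf hf0 => ?_⟩
  obtain ⟨s, hs, hle⟩ := exists_le_setAverage h0 h1 hf.integrableOn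
  refine ⟨s, hs, hle.trans ?_⟩
  rw [setAverage_eq, smul_eq_mul]
  exact mul_le_mul_of_nonneg_left (setIntegral_le_integral hf hf0) (by positivity)

theorem exp_pi_mul_abs_le (t : ℝ) : Real.exp (Real.pi * |t|) ≤ 2 * Real.cosh (Real.pi * t) := by
  have : Real.cosh (Real.pi * t) = Real.cosh (Real.pi * |t|) := by
    rw [← Real.cosh_abs, abs_mul, abs_of_pos Real.pi_pos]
  rw [this, Real.cosh_eq]
  linarith [Real.exp_pos (-(Real.pi * |t|))]

/-- Approximate recovery, with a constant depending on the function, on a lower bound for the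
nonzero eigenvalues of the reference state, and on the dimension. -/
theorem exists_recovery_constant {g : ℝ → ℝ} (hg : IsRegular g) {l : ℝ} (hl : 0 < l) (hl1 : l ≤ 1)
    (N : ℕ) : ∃ K : ℝ, 0 < K ∧
      ∀ (n : Type u) [Fintype n] [DecidableEq n] (m : Type v) [Fintype m] [DecidableEq m]
        (ρ σ : Op n) (Φ : Op n →ₗ[ℂ] Op m),
        ρ.IsHermitian → ∀ hσ : IsState σ, KerLE σ ρ → IsChannel Φ →
        (∀ i, hσ.1.isHermitian.eigenvalues i ≠ 0 → l ≤ hσ.1.isHermitian.eigenvalues i) →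
        Fintype.card n * Fintype.card n ≤ N →
        ∀ t : ℝ, chiSq g ρ σ - chiSq g (Φ ρ) (Φ σ) ≥
            Real.pi / Real.cosh (Real.pi * t) * K *
              traceNorm (ρ - rotatedPetz σ Φ t (Φ ρ)) ^ 2 := by
  obtain ⟨ν, hν, hac⟩ := hg.regular
  -- The intervals `[2k + 1, 2k + 2]` keep the nodes above `1` and at mutual distance at least `1`,
  -- wherever in them the nodes fall.
  have hnode := fun k : Fin (N + 1) => exists_node_le (ν := ν) (a := 2 * ((k : ℕ) : ℝ) + 1)
    (b := 2 * ((k : ℕ) : ℝ) + 2) (by positivity) (by linarith) hac (hν.2.1 1 one_pos)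
  choose κ hκ hnode using hnode
  obtain ⟨K₁, hK₁, hI⟩ := exists_interpolation hl hl1 N
  set V : ℝ := ∑ k, κ k with hV
  have hV0 : 0 ≤ V := Finset.sum_nonneg fun k _ => (hκ k).le
  set Q : ℝ := 3 * (2 ^ (N + 1) * ((N + 1) * ((K₁ + K₁ * K₁) * V))) with hQ
  have hQ0 : 0 ≤ Q := by positivity
  have hl' : 1 ≤ l⁻¹ := (one_le_inv₀ hl).2 hl1
  -- The estimate to come is `T ≤ 2 Q cosh(πt) L`. The `π` cancels the prefactor of the theorem and
  -- the `+ 1` covers `Q = 0`.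
  refine ⟨1 / (Real.pi * (2 * Q + 1)), by positivity, ?_⟩
  intro n _ _ m _ _ ρ σ Φ hρ hσ hker hΦ hmin hcard t
  have h := hσ.1.isHermitian
  have hA : KerLE σ (ρ - σ) := hker.sub (kerLE_refl σ)
  have hA' : (ρ - σ).IsHermitian := hρ.sub h
  obtain ⟨hDint, hDle⟩ := integral_resolvLoss_le hν hΦ hσ.1 hA hA'
  have hDae := ae_resolvLoss_nonneg hν.1 hΦ hσ.1 hA hA'
  set L := chiSq g ρ σ - chiSq g (Φ ρ) (Φ σ) with hL
  have hLe : ∫ s, resolvLoss Φ σ (ρ - σ) s ∂ν ≤ L := by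
    rw [hL, chiSq, chiSq, ← map_sub]; exact hDle
  have hint0 : 0 ≤ ∫ s, resolvLoss Φ σ (ρ - σ) s ∂ν := integral_nonneg_of_ae hDae
  have hnode' := fun k => hnode k _ hDint hDae
  choose s hs hsD using hnode'
  -- Nonzero eigenvalues of a state lie in `[l, 1]`, so their ratios lie in `[l, l⁻¹]`.
  obtain ⟨r, hr1, hr2, hr3⟩ := exists_list_of_card_le (N := N) (l := l)
    ((Finset.univ.filter fun p : n × n => h.eigenvalues p.1 ≠ 0 ∧ h.eigenvalues p.2 ≠ 0).image
      fun p => h.eigenvalues p.1 * (h.eigenvalues p.2)⁻¹)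
    (Finset.card_image_le.trans ((Finset.card_filter_le _ _).trans (by
      rw [Finset.card_univ, Fintype.card_prod]; exact hcard))) hl1 hl' (by
    intro a ha
    obtain ⟨p, hp, rfl⟩ := Finset.mem_image.1 ha
    obtain ⟨-, h1, h2⟩ := Finset.mem_filter.1 hp
    have a1 := hmin _ h1
    have a2 := hmin _ h2
    have b1 := eigenvalues_le_one hσ p.1
    have b2 := eigenvalues_le_one hσ p.2
    have p2 : 0 < h.eigenvalues p.2 := hl.trans_le a2
    constructor
    · rw [← div_eq_mul_inv, le_div_iff₀ p2]
      nlinarith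
    · calc h.eigenvalues p.1 * (h.eigenvalues p.2)⁻¹ ≤ 1 * l⁻¹ := by
            gcongr
        _ = l⁻¹ := one_mul _)
  obtain ⟨c, w, G, hc, hw, hw0, hf, hG0, hG1⟩ := hI t s r (fun k => hs k) hr1 hr2
  set e := Real.exp (Real.pi * |t|) with he
  have he0 : 0 < e := Real.exp_pos _
  have main := traceNorm_sub_rotatedPetz_sq_le hΦ hσ.1 hσ.2 hA hA' t (s := s)
    (fun k => by have := (hs k).1; have : (0 : ℝ) ≤ (k : ℕ) := by positivity
                 linarith)
    (M := K₁ * e) (by positivity) (fun i j hi hj => hw0 _ (hr3 _ (Finset.mem_image.2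
      ⟨(i, j), Finset.mem_filter.2 ⟨Finset.mem_univ _, hi, hj⟩, rfl⟩))) hf hG0 hG1
  have hsub : ρ - σ - rotatedPetz σ Φ t (Φ (ρ - σ)) = ρ - rotatedPetz σ Φ t (Φ ρ) := by
    rw [map_sub, rotatedPetz_sub, rotatedPetz_map_self hΦ hσ.1]; abel
  rw [hsub, Fintype.card_fin] at main
  have hterm : ∀ k, (‖c k‖ ^ 2 + K₁ * e * ‖w k‖ ^ 2) * resolvLoss Φ σ (ρ - σ) (s k)
      ≤ (K₁ + K₁ * K₁) * V * e * L := by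
    intro k
    have h1 : ‖c k‖ ^ 2 + K₁ * e * ‖w k‖ ^ 2 ≤ (K₁ + K₁ * K₁) * e := by
      have := mul_le_mul_of_nonneg_left (hw k) (by positivity : 0 ≤ K₁ * e)
      linarith [hc k]
    have h2 : resolvLoss Φ σ (ρ - σ) (s k) ≤ V * L := by
      refine (hsD k).trans ?_
      have : κ k ≤ V := Finset.single_le_sum (fun j _ => (hκ j).le) (Finset.mem_univ k)
      exact mul_le_mul this hLe hint0 hV0
    have h3 : 0 ≤ V * L := mul_nonneg hV0 (hint0.trans hLe)
    calc _ ≤ (‖c k‖ ^ 2 + K₁ * e * ‖w k‖ ^ 2) * (V * L) :=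
          mul_le_mul_of_nonneg_left h2 (by positivity)
      _ ≤ (K₁ + K₁ * K₁) * e * (V * L) := mul_le_mul_of_nonneg_right h1 h3
      _ = _ := by ring
  have hsum := Finset.sum_le_sum fun k (_ : k ∈ Finset.univ) => hterm k
  rw [Finset.sum_const, Finset.card_univ, Fintype.card_fin, nsmul_eq_mul] at hsum
  set T := traceNorm (ρ - rotatedPetz σ Φ t (Φ ρ)) ^ 2 with hT
  have hL0 : 0 ≤ L := hint0.trans hLe
  have hTle : T ≤ Q * e * L := by
    refine main.trans ((mul_le_mul_of_nonneg_left (mul_le_mul_of_nonneg_left hsum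
      (by positivity)) (by norm_num)).trans (le_of_eq ?_))
    rw [hQ]; push_cast; ring
  have hcosh : 0 < Real.cosh (Real.pi * t) := Real.cosh_pos _
  have hTle2 : T ≤ Q * (2 * Real.cosh (Real.pi * t)) * L :=
    hTle.trans (mul_le_mul_of_nonneg_right (mul_le_mul_of_nonneg_left (exp_pi_mul_abs_le t) hQ0)
      hL0)
  have hpi := Real.pi_pos
  have e1 : Real.pi / Real.cosh (Real.pi * t) * (1 / (Real.pi * (2 * Q + 1))) * T
      = T / (Real.cosh (Real.pi * t) * (2 * Q + 1)) := by
    field_simp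
  rw [ge_iff_le, e1, div_le_iff₀ (by positivity)]
  nlinarith [mul_nonneg hL0 hcosh.le]

end Quantitative

/-! ### Completing the Petz map to a channel. -/

section RecoveryChannel

variable {n : Type u} [Fintype n] [DecidableEq n] {m : Type v} [Fintype m] [DecidableEq m]

/-- Complete positivity. -/
def IsCP (Φ : Op n →ₗ[ℂ] Op m) : Prop :=
  ∀ (k : ℕ) (X : Op (n × Fin k)), X.PosSemidef → (amplify Φ k X).PosSemidef

/-- The block of `X` with indices `a`, `b` in the second tensor factor. -/
def tensorBlock {k : ℕ} (X : Op (n × Fin k)) (a b : Fin k) : Op n :=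
  Matrix.of fun p q => X (p, a) (q, b)

theorem amplify_apply (Φ : Op n →ₗ[ℂ] Op m) {k : ℕ} (X : Op (n × Fin k)) (p q : m × Fin k) :
    amplify Φ k X p q = Φ (tensorBlock X p.2 q.2) p.1 q.1 := rfl

theorem tensorBlock_amplify (Φ : Op n →ₗ[ℂ] Op m) {k : ℕ} (X : Op (n × Fin k)) (a b : Fin k) :
    tensorBlock (amplify Φ k X) a b = Φ (tensorBlock X a b) := rfl

theorem tensorBlock_conjTranspose {k : ℕ} {X : Op (n × Fin k)} (hX : X.IsHermitian)
    (a b : Fin k) : (tensorBlock X a b)ᴴ = tensorBlock X b a := by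
  ext i j
  exact hX.apply _ _

theorem trace_mul_eq_sum_tensorBlock {k : ℕ} (X Z : Op (n × Fin k)) :
    (X * Z).trace = ∑ a, ∑ b, (tensorBlock X a b * tensorBlock Z b a).trace := by
  simp only [Matrix.trace, Matrix.diag, Matrix.mul_apply, Fintype.sum_prod_type, tensorBlock,
    Matrix.of_apply]
  rw [Finset.sum_comm]
  refine Finset.sum_congr rfl fun a _ => ?_
  conv_rhs => rw [Finset.sum_comm]
  exact Finset.sum_congr rfl fun p _ => Finset.sum_comm

theorem IsCP.add {Φ Ψ : Op n →ₗ[ℂ] Op m} (hΦ : IsCP Φ) (hΨ : IsCP Ψ) : IsCP (Φ + Ψ) :=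
  fun k X hX => (hΦ k X hX).add (hΨ k X hX)

theorem IsCP.comp {w : Type*} [Fintype w] [DecidableEq w] {Φ : Op n →ₗ[ℂ] Op m}
    {Ψ : Op m →ₗ[ℂ] Op w} (hΨ : IsCP Ψ) (hΦ : IsCP Φ) : IsCP (Ψ ∘ₗ Φ) :=
  fun k X hX => hΨ k _ (hΦ k X hX)

/-- Conjugation `A ↦ K A K*`. -/
def conjMap (K : Matrix m n ℂ) : Op n →ₗ[ℂ] Op m where
  toFun A := K * A * Kᴴ
  map_add' A B := by simp [Matrix.mul_add, Matrix.add_mul]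
  map_smul' c A := by simp

theorem isCP_conjMap (K : Matrix m n ℂ) : IsCP (conjMap K) := by
  intro k X hX
  have e : amplify (conjMap K) k X
      = (Matrix.kroneckerMap (fun x y => x * y) K (1 : Op (Fin k))) * X *
        (Matrix.kroneckerMap (fun x y => x * y) K (1 : Op (Fin k)))ᴴ := by
    ext ⟨p, a⟩ ⟨q, b⟩
    simp [amplify_apply, tensorBlock, conjMap, Matrix.mul_apply, Fintype.sum_prod_type,
      Matrix.one_apply, Finset.sum_mul, apply_ite]
  rw [e]
  exact hX.mul_mul_conjTranspose_same _

/-- The replacement map `A ↦ tr(A) σ`. -/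
def replaceMap (σ : Op m) : Op n →ₗ[ℂ] Op m where
  toFun A := A.trace • σ
  map_add' A B := by simp [add_smul]
  map_smul' c A := by simp [smul_smul]

theorem isCP_replaceMap {σ : Op m} (hσ : σ.PosSemidef) :
    IsCP (replaceMap σ : Op n →ₗ[ℂ] Op m) := by
  intro k X hX
  have e : amplify (replaceMap σ : Op n →ₗ[ℂ] Op m) k X
      = Matrix.kroneckerMap (fun x y => x * y) σ
        (∑ i, X.submatrix (fun a : Fin k => (i, a)) (fun a => (i, a))) := by
    ext ⟨p, a⟩ ⟨q, b⟩
    simp [amplify, replaceMap, Matrix.trace, Matrix.sum_apply, mul_comm]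
  rw [e]
  exact hσ.kronecker (Matrix.posSemidef_sum _ fun i _ => hX.submatrix _)

theorem trace_mul_nonneg {X Y : Op n} (hX : X.PosSemidef) (hY : Y.PosSemidef) :
    0 ≤ (X * Y).trace := by
  have h1 : opPow X (1 / 2) * opPow X (1 / 2) = X := by
    rw [opPow_mul hX.isHermitian]
    convert opPow_one hX.isHermitian using 2
    norm_num
  have h2 : (opPow X (1 / 2))ᴴ = opPow X (1 / 2) := by
    rw [opPow_conjTranspose hX]; simp
  have h3 := (hY.mul_mul_conjTranspose_same (opPow X (1 / 2))).trace_nonneg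
  rwa [h2, Matrix.trace_mul_comm, ← mul_assoc, h1] at h3

/-- The Hilbert-Schmidt adjoint as a linear map. -/
def adjointMap (Φ : Op n →ₗ[ℂ] Op m) : Op m →ₗ[ℂ] Op n where
  toFun := hsAdjoint Φ
  map_add' := hsAdjoint_add Φ
  map_smul' := hsAdjoint_smul Φ

theorem trace_hsAdjoint_mul {Φ : Op n →ₗ[ℂ] Op m} (hΦ : IsChannel Φ) (Y : Op m) (X : Op n) :
    (hsAdjoint Φ Y * X).trace = (Y * Φ X).trace := by
  have := trace_hsAdjoint Φ X Yᴴ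
  rwa [hsAdjoint_conjTranspose hΦ, Matrix.conjTranspose_conjTranspose,
    Matrix.conjTranspose_conjTranspose] at this

theorem trace_amplify_adjointMap_mul {Φ : Op n →ₗ[ℂ] Op m} (hΦ : IsChannel Φ) (k : ℕ)
    (X : Op (m × Fin k)) (Z : Op (n × Fin k)) :
    (amplify (adjointMap Φ) k X * Z).trace = (X * amplify Φ k Z).trace := by
  rw [trace_mul_eq_sum_tensorBlock, trace_mul_eq_sum_tensorBlock]
  refine Finset.sum_congr rfl fun a _ => Finset.sum_congr rfl fun b _ => ?_
  rw [tensorBlock_amplify, tensorBlock_amplify]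
  exact trace_hsAdjoint_mul hΦ _ _

/-- Amplification commutes with taking adjoints, so testing against a rank-one operator moves
positivity onto the amplification of `Φ`. -/
theorem isCP_adjointMap {Φ : Op n →ₗ[ℂ] Op m} (hΦ : IsChannel Φ) : IsCP (adjointMap Φ) := by
  intro k X hX
  rw [Matrix.posSemidef_iff_dotProduct_mulVec]
  refine ⟨?_, fun w => ?_⟩
  · ext ⟨p, a⟩ ⟨q, b⟩
    rw [Matrix.conjTranspose_apply]
    rw [amplify_apply, amplify_apply, ← tensorBlock_conjTranspose hX.isHermitian b a]
    exact (congrFun (congrFun (hsAdjoint_conjTranspose hΦ (tensorBlock X b a)) p) q).symm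
  · have h := trace_mul_nonneg hX (hΦ.1 k _ (Matrix.posSemidef_vecMulVec_self_star w))
    rwa [← trace_amplify_adjointMap_mul hΦ, Matrix.mul_vecMulVec, Matrix.trace_vecMulVec,
      dotProduct_comm] at h

/-- If the Petz map recovers `ρ`, then the channel is sufficient. -/
theorem isSufficient_of_petz {Φ : Op n →ₗ[ℂ] Op m} (hΦ : IsChannel Φ) {ρ σ : Op n}
    (hρ : ρ.IsHermitian) (hσ : IsState σ) (hker : KerLE σ ρ)
    (h : ρ = rotatedPetz σ Φ 0 (Φ ρ)) : IsSufficient Φ ρ σ := by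
  have hτ := hΦ.map_posSemidef hσ.1
  set S := opPow σ (1 / 2) with hS
  set T := opPow (Φ σ) (-1 / 2) with hT
  set E := 1 - opPow (Φ σ) 0 with hE
  have hSh : Sᴴ = S := by
    rw [hS, opPow_conjTranspose hσ.1]; simp
  have hTh : Tᴴ = T := by
    rw [hT, opPow_conjTranspose hτ]; simp
  have hPh : (opPow (Φ σ) 0)ᴴ = opPow (Φ σ) 0 := by
    rw [opPow_conjTranspose hτ]; simp
  have hEh : Eᴴ = E := by
    rw [hE, Matrix.conjTranspose_sub, hPh, Matrix.conjTranspose_one]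
  have hPP : opPow (Φ σ) 0 * opPow (Φ σ) 0 = opPow (Φ σ) 0 := by
    rw [opPow_mul hτ.isHermitian, add_zero]
  have hEE : E * E = E := by
    rw [hE, mul_sub, sub_mul, sub_mul, hPP]; simp
  have hSS : S * S = σ := by
    rw [hS, opPow_mul hσ.1.isHermitian]
    convert opPow_one hσ.1.isHermitian using 2
    norm_num
  have hTT : T * Φ σ * T = opPow (Φ σ) 0 := by
    conv_lhs => lhs; rhs; rw [← opPow_one hτ.isHermitian]
    rw [hT, opPow_mul hτ.isHermitian, opPow_mul hτ.isHermitian]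
    congr 1
    norm_num
  have hτE : Φ σ * E = 0 := mul_one_sub_opPow_zero hτ.isHermitian
  have hρE : Φ ρ * E = 0 := by
    have hk := hker.map hΦ hσ.1 hρ
    ext i j
    have h1 : Φ σ *ᵥ (fun a => E a j) = 0 := by
      ext b; exact congrFun (congrFun hτE b) j
    exact congrFun (hk _ h1) i
  -- The Petz map preserves the trace only on the support of `Φ(σ)`. The second summand restores the
  -- trace lost on the complement `E`, and vanishes at `Φ(ρ)` and `Φ(σ)`.
  set R : Op m →ₗ[ℂ] Op n := conjMap S ∘ₗ adjointMap Φ ∘ₗ conjMap T + replaceMap σ ∘ₗ conjMap E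
    with hR
  have hRapp : ∀ A, R A = S * hsAdjoint Φ (T * A * T) * S + (E * A * E).trace • σ := by
    intro A
    simp [hR, conjMap, adjointMap, replaceMap, hSh, hTh, hEh]
  have hpetz : ∀ A, rotatedPetz σ Φ 0 A = S * hsAdjoint Φ (T * A * T) * S := by
    intro A
    simp [rotatedPetz, hS, hT]
  refine ⟨R, ⟨?_, fun A => ?_⟩, ?_, ?_⟩
  · exact ((isCP_conjMap S).comp ((isCP_adjointMap hΦ).comp (isCP_conjMap T))).add
      ((isCP_replaceMap hσ.1).comp (isCP_conjMap E))
  · rw [hRapp, Matrix.trace_add, Matrix.trace_smul, hσ.2, smul_eq_mul, mul_one,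
      Matrix.trace_mul_comm, ← mul_assoc, hSS, Matrix.trace_mul_comm σ, trace_hsAdjoint_mul hΦ]
    have e1 : (T * A * T * Φ σ).trace = (A * opPow (Φ σ) 0).trace := by
      rw [← hTT, mul_assoc, mul_assoc, Matrix.trace_mul_comm]
      simp only [mul_assoc]
    have e2 : (E * A * E).trace = (A * E).trace := by
      rw [mul_assoc, Matrix.trace_mul_comm, mul_assoc, hEE]
    rw [e1, e2, ← Matrix.trace_add, ← mul_add, hE, add_sub_cancel, mul_one]
  · rw [hRapp, ← hpetz, ← h, mul_assoc, hρE]; simp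
  · rw [hRapp, ← hpetz, rotatedPetz_map_self hΦ hσ.1, mul_assoc, hτE]; simp

end RecoveryChannel

/-! ### Existence of a regular function. -/

section RegularExample

/-- The spectral weights `k` are independent of `f`; an integral over a family of functions can thus
be taken inside the quadratic form. -/
theorem exists_sum_eq_dotProduct_matFun {n : Type u} [Fintype n] [DecidableEq n] {X : Op n}
    (h : X.IsHermitian) (w : n → ℂ) : ∃ k : n → ℝ, ∀ f : ℝ → ℝ,
      star w ⬝ᵥ (matFun (fun x => (f x : ℂ)) X *ᵥ w)
        = ((∑ i, f (h.eigenvalues i) * k i : ℝ) : ℂ) := by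
  refine ⟨fun i => Complex.normSq (((h.eigenvectorUnitary : Op n)ᴴ *ᵥ w) i), fun f => ?_⟩
  rw [matFun_eq h, ofEigCoord, ← Matrix.mulVec_mulVec, ← Matrix.mulVec_mulVec,
    Matrix.dotProduct_mulVec, ← Matrix.conjTranspose_conjTranspose (h.eigenvectorUnitary : Op n),
    ← Matrix.star_mulVec, Matrix.conjTranspose_conjTranspose, dotProduct]
  push_cast
  refine Finset.sum_congr rfl fun i _ => ?_
  rw [Matrix.mulVec_diagonal, Complex.normSq_eq_conj_mul_self, Pi.star_apply, Complex.star_def]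
  ring

theorem matFun_resolvent_eq_inv {n : Type u} [Fintype n] [DecidableEq n] {X : Op n}
    (hX : X.PosDef) {s : ℝ} (hs : 0 ≤ s) :
    matFun (fun x => ((1 / (s + x) : ℝ) : ℂ)) X = ((s : ℂ) • (1 : Op n) + X)⁻¹ := by
  symm
  apply Matrix.inv_eq_left_inv
  have h := hX.isHermitian
  apply eigCoord_injective h
  rw [eigCoord_mul, eigCoord_add, eigCoord_smul, eigCoord_one, eigCoord_self, eigCoord_matFun,
    ← Matrix.diagonal_one, ← Matrix.diagonal_smul, Matrix.diagonal_add,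
    Matrix.diagonal_mul_diagonal]
  congr 1
  ext i
  have : 0 < h.eigenvalues i := hX.eigenvalues_pos i
  have h2 : (s : ℂ) + h.eigenvalues i ≠ 0 := by
    have : s + h.eigenvalues i ≠ 0 := by positivity
    exact_mod_cast this
  simp [h2]

/-- The inverse is operator anti-monotone. -/
theorem inv_sub_inv_posSemidef {n : Type u} [Fintype n] [DecidableEq n] {P Q : Op n}
    (hP : P.PosDef) (hQ : Q.PosDef) (h : (Q - P).PosSemidef) : (P⁻¹ - Q⁻¹).PosSemidef := by
  have uP := (Matrix.isUnit_iff_isUnit_det _).1 hP.isUnit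
  have uQ := (Matrix.isUnit_iff_isUnit_det _).1 hQ.isUnit
  have hPi : (P⁻¹)ᴴ = P⁻¹ := hP.isHermitian.inv.eq
  have hQi : (Q⁻¹)ᴴ = Q⁻¹ := hQ.isHermitian.inv.eq
  -- An algebraic identity displaying the difference as a sum of two congruences of positive
  -- operators.
  have e : P⁻¹ - Q⁻¹ = (P⁻¹ - Q⁻¹)ᴴ * P * (P⁻¹ - Q⁻¹) + (Q⁻¹)ᴴ * (Q - P) * Q⁻¹ := by
    have e1 : P⁻¹ * P = 1 := Matrix.nonsing_inv_mul P uP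
    have e2 : P * P⁻¹ = 1 := Matrix.mul_nonsing_inv P uP
    have e3 : Q⁻¹ * Q = 1 := Matrix.nonsing_inv_mul Q uQ
    rw [Matrix.conjTranspose_sub, hPi, hQi, sub_mul, e1, mul_sub, sub_mul, sub_mul, mul_assoc _ P,
      e2, mul_sub, sub_mul, e3]
    simp only [one_mul, mul_one]
    abel
  rw [e]
  exact (hP.posSemidef.conjTranspose_mul_mul_same _).add (h.conjTranspose_mul_mul_same _)

theorem operatorAntitone_of_integral {g : ℝ → ℝ} {ν : Measure ℝ}
    (hν0 : ν (Set.Iio 0) = 0)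
    (hν : ∀ x : ℝ, 0 < x → Integrable (fun s : ℝ => 1 / (s + x)) ν)
    (hg : ∀ x : ℝ, 0 < x → g x = ∫ s, 1 / (s + x) ∂ν) : OperatorAntitone g := by
  intro d X Y hX hXY
  have hY : Y.PosDef := by
    have := hX.add_posSemidef hXY
    rwa [add_sub_cancel] at this
  have hherm : ∀ Z : Op (Fin d), Z.IsHermitian →
      (matFun (fun x => (g x : ℂ)) Z).IsHermitian := fun Z hZ => by
    rw [Matrix.IsHermitian, matFun_conjTranspose hZ]
    simp
  rw [Matrix.posSemidef_iff_dotProduct_mulVec]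
  refine ⟨(hherm X hX.isHermitian).sub (hherm Y hY.isHermitian), fun w => ?_⟩
  obtain ⟨k, hk⟩ := exists_sum_eq_dotProduct_matFun hX.isHermitian w
  obtain ⟨k', hk'⟩ := exists_sum_eq_dotProduct_matFun hY.isHermitian w
  have hi : ∀ i, Integrable (fun s => 1 / (s + hX.isHermitian.eigenvalues i) * k i) ν :=
    fun i => (hν _ (hX.eigenvalues_pos i)).mul_const _
  have hi' : ∀ i, Integrable (fun s => 1 / (s + hY.isHermitian.eigenvalues i) * k' i) ν :=
    fun i => (hν _ (hY.eigenvalues_pos i)).mul_const _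
  rw [Matrix.sub_mulVec, dotProduct_sub, hk, hk', ← Complex.ofReal_sub]
  have e : ∑ i, g (hX.isHermitian.eigenvalues i) * k i
      - ∑ i, g (hY.isHermitian.eigenvalues i) * k' i
      = ∫ s, (∑ i, 1 / (s + hX.isHermitian.eigenvalues i) * k i
        - ∑ i, 1 / (s + hY.isHermitian.eigenvalues i) * k' i) ∂ν := by
    rw [integral_sub (integrable_finsetSum _ fun i _ => hi i)
      (integrable_finsetSum _ fun i _ => hi' i), integral_finsetSum _ fun i _ => hi i,
      integral_finsetSum _ fun i _ => hi' i]
    congr 1 <;> refine Finset.sum_congr rfl fun i _ => ?_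
    · rw [integral_mul_const, hg _ (hX.eigenvalues_pos i)]
    · rw [integral_mul_const, hg _ (hY.eigenvalues_pos i)]
  rw [e]
  have hae : ∀ᵐ s ∂ν, s ∉ Set.Iio (0 : ℝ) := measure_eq_zero_iff_ae_notMem.1 hν0
  refine Complex.zero_le_real.2 (integral_nonneg_of_ae ?_)
  filter_upwards [hae] with s hs
  have hs0 : 0 ≤ s := not_lt.1 hs
  have hone : ((s : ℂ) • (1 : Op (Fin d))).PosSemidef :=
    Matrix.PosSemidef.one.smul (by exact_mod_cast hs0)
  have h1 := inv_sub_inv_posSemidef (hX.posSemidef_add hone) (hY.posSemidef_add hone)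
    (by rwa [add_sub_add_left_eq_sub])
  rw [← matFun_resolvent_eq_inv hX hs0, ← matFun_resolvent_eq_inv hY hs0,
    Matrix.posSemidef_iff_dotProduct_mulVec] at h1
  have h2 := h1.2 w
  rw [Matrix.sub_mulVec, dotProduct_sub, hk (fun x => 1 / (s + x)), hk' (fun x => 1 / (s + x)),
    ← Complex.ofReal_sub] at h2
  exact Complex.zero_le_real.1 h2

/-- Keeps condition (c) from being vacuous and supplies the witness for (b). A finite measure
equivalent to Lebesgue measure on `(0, ∞)` makes every resolvent integrable. -/
theorem exists_isRegular : ∃ g : ℝ → ℝ, IsRegular g := by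
  set ν : Measure ℝ := (volume.restrict (Set.Ioi (0 : ℝ))).toFinite with hνdef
  have hac : volume.restrict (Set.Ioi (0 : ℝ)) ≪ ν := absolutelyContinuous_toFinite _
  have hca : ν ≪ volume.restrict (Set.Ioi (0 : ℝ)) := toFinite_absolutelyContinuous _
  have hpos : ∀ᵐ s ∂ν, 0 < s := hca.ae_le (ae_restrict_mem measurableSet_Ioi)
  have hneg : ν (Set.Iio 0) = 0 := by
    apply hca
    rw [Measure.restrict_apply measurableSet_Iio]
    have : Set.Iio (0 : ℝ) ∩ Set.Ioi 0 = ∅ := by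
      ext x; simp only [Set.mem_inter_iff, Set.mem_Iio, Set.mem_Ioi, Set.mem_empty_iff_false]
      constructor
      · rintro ⟨h1, h2⟩; linarith
      · exact False.elim
    rw [this, measure_empty]
  have hint : ∀ x : ℝ, 0 < x → Integrable (fun s : ℝ => 1 / (s + x)) ν := by
    intro x hx
    refine Integrable.of_bound (C := 1 / x) (by
      exact (measurable_const.div (measurable_id.add_const x)).aestronglyMeasurable) ?_
    filter_upwards [hpos] with s hs
    rw [Real.norm_of_nonneg (by positivity)]
    exact one_div_le_one_div_of_le hx (by linarith)
  have hne : ν ≠ 0 := by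
    intro h
    have := hac (s := Set.univ) (by rw [h]; rfl)
    simp at this
  refine ⟨fun x => ∫ s, 1 / (s + x) ∂ν, fun x hx => ?_, operatorAntitone_of_integral hneg hint
    fun _ _ => rfl, ν, ⟨hneg, hint, 0, le_rfl, fun x _ => by simp⟩, hac⟩
  have hnn : 0 ≤ᵐ[ν] fun s => 1 / (s + x) := by
    filter_upwards [hpos] with s hs
    positivity
  refine lt_of_le_of_ne (integral_nonneg_of_ae hnn) fun h0 => hne ?_
  have h1 := (integral_eq_zero_iff_of_nonneg_ae hnn (hint x hx)).1 h0.symm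
  rw [← ae_eq_bot, ← Filter.eventually_false_iff_eq_bot]
  filter_upwards [h1, hpos] with s hs hs0
  have : 0 < 1 / (s + x) := by positivity
  exact this.ne' hs

end RegularExample

/-! ### Equality of divergences and sufficiency. -/

section Sufficiency

variable {n : Type u} [Fintype n] [DecidableEq n] {m : Type v} [Fintype m] [DecidableEq m]

theorem chiSq_mono {g : ℝ → ℝ} (hg : IsRegular g) {ρ σ : Op n} (hρ : ρ.IsHermitian)
    (hσ : σ.PosSemidef) (hker : KerLE σ ρ) {Φ : Op n →ₗ[ℂ] Op m} (hΦ : IsChannel Φ) :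
    chiSq g (Φ ρ) (Φ σ) ≤ chiSq g ρ σ := by
  obtain ⟨ν, hν, -⟩ := hg.regular
  rw [chiSq, chiSq, ← map_sub]
  exact metric_mono hν hΦ hσ (hker.sub (kerLE_refl σ)) (hρ.sub hσ.isHermitian)

/-- Sufficient channels preserve all regular divergences. -/
theorem IsSufficient.chiSq_eq {g : ℝ → ℝ} (hg : IsRegular g) {ρ σ : Op n} (hρ : ρ.IsHermitian)
    (hσ : σ.PosSemidef) (hker : KerLE σ ρ) {Φ : Op n →ₗ[ℂ] Op m} (hΦ : IsChannel Φ)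
    (h : IsSufficient Φ ρ σ) : chiSq g ρ σ = chiSq g (Φ ρ) (Φ σ) := by
  obtain ⟨R, hR, h1, h2⟩ := h
  have h3 := chiSq_mono hg (hΦ.map_isHermitian hρ) (hΦ.map_posSemidef hσ) (hker.map hΦ hσ hρ) hR
  rw [h1, h2] at h3
  exact le_antisymm h3 (chiSq_mono hg hρ hσ hker hΦ)

/-- Preservation of one regular divergence implies sufficiency. -/
theorem isSufficient_of_chiSq_eq {g : ℝ → ℝ} (hg : IsRegular g) {ρ σ : Op n}
    (hρ : ρ.IsHermitian) (hσ : IsState σ) (hker : KerLE σ ρ) {Φ : Op n →ₗ[ℂ] Op m}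
    (hΦ : IsChannel Φ) (h : chiSq g ρ σ = chiSq g (Φ ρ) (Φ σ)) : IsSufficient Φ ρ σ := by
  have hE := hσ.1.isHermitian
  -- Inserting `1` makes the set nonempty and its minimum at most `1`; the minimum bounds the
  -- nonzero eigenvalues from below.
  set s : Finset ℝ := insert 1 ((Finset.univ.filter fun i => hE.eigenvalues i ≠ 0).image
    hE.eigenvalues) with hs
  have hne : s.Nonempty := Finset.insert_nonempty _ _
  have hpos : 0 < s.min' hne := by
    rw [Finset.lt_min'_iff]
    intro y hy
    rcases Finset.mem_insert.1 hy with rfl | hy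
    · exact one_pos
    · obtain ⟨i, hi, rfl⟩ := Finset.mem_image.1 hy
      exact lt_of_le_of_ne (hσ.1.eigenvalues_nonneg i) (Finset.mem_filter.1 hi).2.symm
  obtain ⟨K, hK, H⟩ := exists_recovery_constant.{u, v} hg hpos
    (Finset.min'_le s 1 (Finset.mem_insert_self _ _)) (Fintype.card n * Fintype.card n)
  have h1 := H n m ρ σ Φ hρ hσ hker hΦ (fun i hi => Finset.min'_le s _ (Finset.mem_insert_of_mem
    (Finset.mem_image.2 ⟨i, Finset.mem_filter.2 ⟨Finset.mem_univ i, hi⟩, rfl⟩))) le_rfl 0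
  rw [h, sub_self] at h1
  have hc : 0 < Real.pi / Real.cosh (Real.pi * 0) * K :=
    mul_pos (div_pos Real.pi_pos (Real.cosh_pos _)) hK
  have h2 : traceNorm (ρ - rotatedPetz σ Φ 0 (Φ ρ)) ^ 2 = 0 :=
    le_antisymm (nonpos_of_mul_nonpos_right h1 hc) (sq_nonneg _)
  exact isSufficient_of_petz hΦ hρ hσ hker
    (sub_eq_zero.1 (traceNorm_eq_zero (pow_eq_zero_iff two_ne_zero |>.1 h2)))

theorem lt_eigenvalues_of_posDef {σ : Op n} (hσ : σ.IsHermitian) {l : ℝ}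
    (h : (σ - (l : ℂ) • (1 : Op n)).PosDef) (i : n) : l < hσ.eigenvalues i := by
  have hne : (hσ.eigenvectorBasis i).ofLp ≠ 0 := fun h0 =>
    hσ.eigenvectorBasis.orthonormal.ne_zero i (by ext j; exact congrFun h0 j)
  have h1 := h.dotProduct_mulVec_pos hne
  have h2 : 0 < star (hσ.eigenvectorBasis i).ofLp ⬝ᵥ (hσ.eigenvectorBasis i).ofLp := by
    exact Matrix.dotProduct_star_self_pos_iff.2 hne
  rw [Matrix.sub_mulVec, hσ.mulVec_eigenvectorBasis, Matrix.smul_mulVec, Matrix.one_mulVec,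
    ← Complex.coe_smul, ← sub_smul, dotProduct_smul, smul_eq_mul] at h1
  have h3 := pos_of_mul_pos_left h1 h2.le
  rw [← Complex.ofReal_sub] at h3
  linarith [Complex.zero_lt_real.1 h3]

end Sufficiency

end QChi

end

/-! ### Assembly of the two statements. -/

theorem theorem1p4 :
    -- exact recovery: sufficiency, preservation for some, preservation for all regular divergences
    (∀ (n : Type u) [Fintype n] [DecidableEq n] (m : Type v) [Fintype m] [DecidableEq m]
      (ρ σ : QChi.Op n) (Φ : QChi.Op n →ₗ[ℂ] QChi.Op m),
      QChi.IsState ρ → QChi.IsState σ → QChi.supp ρ ≤ QChi.supp σ → QChi.IsChannel Φ →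
        (QChi.IsSufficient Φ ρ σ ↔
          ∃ g : ℝ → ℝ, QChi.IsRegular g ∧ QChi.chiSq g ρ σ = QChi.chiSq g (Φ ρ) (Φ σ)) ∧
        (QChi.IsSufficient Φ ρ σ ↔
          ∀ g : ℝ → ℝ, QChi.IsRegular g → QChi.chiSq g ρ σ = QChi.chiSq g (Φ ρ) (Φ σ))) ∧
    -- approximate recovery, with a constant depending only on the divergence and on `lam`
    (∀ g : ℝ → ℝ, QChi.IsRegular g → ∀ lam : ℝ, 0 < lam → ∃ K : ℝ, 0 < K ∧
      ∀ (n : Type u) [Fintype n] [DecidableEq n] (m : Type v) [Fintype m] [DecidableEq m]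
        (ρ σ : QChi.Op n) (Φ : QChi.Op n →ₗ[ℂ] QChi.Op m),
        QChi.IsState ρ → QChi.IsState σ → QChi.IsChannel Φ →
        (σ - (lam : ℂ) • (1 : QChi.Op n)).PosDef →
        ∀ t : ℝ,
          QChi.chiSq g ρ σ - QChi.chiSq g (Φ ρ) (Φ σ) ≥
            Real.pi / Real.cosh (Real.pi * t) * K *
              QChi.traceNorm (ρ - QChi.rotatedPetz σ Φ t (Φ ρ)) ^ 2) := by
  refine ⟨?_, ?_⟩
  · intro n _ _ m _ _ ρ σ Φ hρ hσ hsupp hΦ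
    have hker := QChi.kerLE_of_supp_le hρ.1.isHermitian hσ.1.isHermitian hsupp
    have hall : QChi.IsSufficient Φ ρ σ → ∀ g : ℝ → ℝ, QChi.IsRegular g →
        QChi.chiSq g ρ σ = QChi.chiSq g (Φ ρ) (Φ σ) := fun h g hg =>
      h.chiSq_eq hg hρ.1.isHermitian hσ.1 hker hΦ
    have hsome : ∀ g : ℝ → ℝ, QChi.IsRegular g →
        QChi.chiSq g ρ σ = QChi.chiSq g (Φ ρ) (Φ σ) → QChi.IsSufficient Φ ρ σ := fun g hg h =>
      QChi.isSufficient_of_chiSq_eq hg hρ.1.isHermitian hσ hker hΦ h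
    obtain ⟨g₀, hg₀⟩ := QChi.exists_isRegular
    exact ⟨⟨fun h => ⟨g₀, hg₀, hall h g₀ hg₀⟩, fun ⟨g, hg, h⟩ => hsome g hg h⟩,
      ⟨hall, fun h => hsome g₀ hg₀ (h g₀ hg₀)⟩⟩
  · intro g hg lam hlam
    -- Eigenvalues above `lam` summing to one force `dim ≤ 1 / lam`, so the dimension-dependent
    -- constant becomes one depending only on `g` and `lam`.
    set N : ℕ := ⌈lam⁻¹⌉₊ with hN
    obtain ⟨K, hK, H⟩ := QChi.exists_recovery_constant.{u, v} hg (lt_min hlam one_pos)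
      (min_le_right lam 1) (N * N)
    refine ⟨K, hK, fun n _ _ m _ _ ρ σ Φ hρ hσ hΦ hpd t => ?_⟩
    have h := hσ.1.isHermitian
    have hlt : ∀ i, lam < h.eigenvalues i := QChi.lt_eigenvalues_of_posDef h hpd
    have hcard : Fintype.card n ≤ N := by
      have h1 : (Fintype.card n : ℝ) * lam ≤ 1 := by
        calc (Fintype.card n : ℝ) * lam = ∑ _i : n, lam := by simp
          _ ≤ ∑ i, h.eigenvalues i := Finset.sum_le_sum fun i _ => (hlt i).le
          _ = 1 := QChi.sum_eigenvalues_eq_one hσ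
      have h2 : (Fintype.card n : ℝ) ≤ lam⁻¹ := by
        rwa [← one_div, le_div_iff₀ hlam]
      exact_mod_cast h2.trans (Nat.le_ceil _)
    have hker : QChi.KerLE σ ρ := by
      intro w hw
      have hpos : σ.PosDef := h.posDef_iff_eigenvalues_pos.2 fun i => hlam.trans (hlt i)
      have h0 : w = 0 := by
        by_contra hne
        have := hpos.dotProduct_mulVec_pos hne
        rw [hw, dotProduct_zero] at this
        exact lt_irrefl _ this
      rw [h0, Matrix.mulVec_zero]
    exact H n m ρ σ Φ hρ.1.isHermitian hσ hker hΦ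
      (fun i _ => (min_le_left _ _).trans (hlt i).le) (Nat.mul_le_mul hcard hcard) t
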